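/- Let $F$ be a $\sigma$-finite measure on $\mathbb R$ that is not concentrated on a single point, let $\Omega$ be the interior of its natural parameter space $\{\xi:\int e^{\xi x}\,dF(x)<\infty\}$, and for $\xi\in\Omega$ put $b(\xi)=\log\int e^{\xi x}\,dF(x)$ and $f_\xi(x)=\exp(\xi x-b(\xi))$, a probability density with respect to $F$. Let $X_1,X_2,\dots$ be real random variables which, under $\mathbf P_\xi$ (with expectation $\mathbf E_\xi$), $\xi\in\Omega$, are independent and identically distributed with density $f_\xi$. Let $\theta_0<\theta_1<\lambda$ with $\theta_0,\lambda\in\Omega$. Put $I(\lambda,\theta)=\mathbf E_\lambda\log\big(f_\lambda(X_1)/f_\theta(X_1)\big)$, $$M(a)=\inf\Big\{n\ge 1:\ \sum_{i=1}^n\log\frac{f_\lambda(X_i)}{f_\theta(X_i)}\ \ge\ I(\lambda,\theta)\,a\ \text{ for all }\theta_0\le\theta\le\theta_1\Big\}\qquad(a>0,\ \inf\emptyset=\infty),$$ $$C=\left(\frac{\lambda-\theta_1}{I(\lambda,\theta_1)}-\frac{\lambda-\theta_0}{I(\lambda,\theta_0)}\right)\sqrt{\frac{b''(\lambda)}{2\pi}}.$$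 Then $C>0$, each $M(a)$ is a stopping time with respect to $(X_n)_{n\ge1}$, and there are functions $\delta(a)\to0$ and $\varepsilon(a)\to0$ as $a\to\infty$ such that the following holds. Let $\{N(a)\}_{a>0}$ be any family of stopping times with respect to $(X_n)_{n\ge1}$, with values in $\{0,1,2,\dots,\infty\}$, such that $\mathbf E_\lambda N(a)\le\mathbf E_\lambda M(a)$ for all $a>0$. Then for all $\theta\in[\theta_0,\theta_1]$ and all $a>0$, $\mathbf P_\theta(N(a)<\infty)>0$ and $$\frac{|\log\mathbf P_\theta(N(a)<\infty)|}{I(\lambda,\theta)}\ \le\ a+(C+\delta(a))\sqrt a .$$ Moreover $M(a)$ asymptotically minimizes the error probabilities simultaneously for all $\theta\in[\theta_0,\theta_1]$ among all such stopping times: for the same $N(a)$, $\theta$ and $a$, $$\frac{|\log\mathbf P_\theta(N(a)<\infty)|}{I(\lambda,\theta)}\le\frac{|\log\mathbf P_\theta(M(a)<\infty)|}{I(\lambda,\theta)}+(C+\delta(a))\sqrt a,$$ $$|\log\mathbf P_\theta(N(a)<\infty)|\le(1+\varepsilon(a))\,|\log\mathbf P_\theta(M(a)<\infty)| .$$ 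-/

import Mathlib

open MeasureTheory ProbabilityTheory Filter Topology

noncomputable section

namespace ExpFamilyTest

/-- The interior of the natural parameter space `{ξ | ∫ exp (ξ x) dF(x) < ∞}` (equal to the natural
parameter space when the latter is an open interval). -/
def naturalParam (F : Measure ℝ) : Set ℝ := interior (integrableExpSet id F)

/-- The log-normalizer `b(ξ) = log ∫ exp (ξ x) dF(x)`, i.e. the function that makes
`exp (ξ x - b ξ)` a probability density with respect to `F`. -/
def logNorm (F : Measure ℝ) (ξ : ℝ) : ℝ := Real.log (∫ x, Real.exp (ξ * x) ∂F)

/-- The density `f_ξ(x) = exp (ξ x - b(ξ))` with respect to `F`. -/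
def density (F : Measure ℝ) (ξ x : ℝ) : ℝ := Real.exp (ξ * x - logNorm F ξ)

/-- The law on `ℝ` with density `f_ξ` with respect to `F`. -/
def law (F : Measure ℝ) (ξ : ℝ) : Measure ℝ :=
  F.withDensity fun x => ENNReal.ofReal (density F ξ x)

/-- The log-likelihood ratio `log (f_lam(x) / f_θ(x))` of one observation. -/
def logLR (F : Measure ℝ) (lam θ x : ℝ) : ℝ := Real.log (density F lam x / density F θ x)

/-- The Kullback-Leibler information number `I(lam, θ) = E_lam log (f_lam(X) / f_θ(X))`. -/
def klInfo (F : Measure ℝ) (lam θ : ℝ) : ℝ := ∫ x, logLR F lam θ x ∂(law F lam)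

/-- `C = ((λ - θ₁) / I(λ, θ₁) - (λ - θ₀) / I(λ, θ₀)) √(b''(λ) / (2π))`. -/
def constC (F : Measure ℝ) (θ₀ θ₁ lam : ℝ) : ℝ :=
  ((lam - θ₁) / klInfo F lam θ₁ - (lam - θ₀) / klInfo F lam θ₀) *
    √(iteratedDeriv 2 (logNorm F) lam / (2 * Real.pi))

/-- Under `P` the variables `X 0, X 1, …` are independent, each with distribution `Q`. -/
structure IsIID {Ω : Type*} [MeasurableSpace Ω] (X : ℕ → Ω → ℝ) (P : Measure Ω)
    (Q : Measure ℝ) : Prop where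
  isProbabilityMeasure : IsProbabilityMeasure P
  indep : iIndepFun X P
  map_eq : ∀ i, P.map (X i) = Q

/-- The filtration of the observations. The `i`-th observation `X_i` (`i ≥ 1`) is `X (i - 1)`, so
that the `σ`-algebra at time `n` is `σ(X_1, …, X_n) = σ(X 0, …, X (n - 1))`. -/
def obsFiltration {Ω : Type*} [m : MeasurableSpace Ω] (X : ℕ → Ω → ℝ)
    (hX : ∀ i, Measurable (X i)) : Filtration ℕ m where
  seq n := ⨆ (i : ℕ) (_ : i < n), MeasurableSpace.comap (X i) inferInstance
  mono' _ _ hnk := iSup₂_le fun i hi => le_iSup₂_of_le i (lt_of_lt_of_le hi hnk) le_rfl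
  le' _ := iSup₂_le fun i _ => (hX i).comap_le

/-- The stopping time `M(a) = inf {n ≥ 1 : ∑_{i=1}^n log (f_lam(X_i) / f_θ(X_i)) ≥ I(lam, θ) a
for all θ ∈ [θ₀, θ₁]}`, equal to `∞` when there is no such `n`. -/
def stopM {Ω : Type*} (F : Measure ℝ) (X : ℕ → Ω → ℝ) (θ₀ θ₁ lam a : ℝ) (ω : Ω) : ℕ∞ :=
  ⨅ (n : ℕ) (_ : 1 ≤ n ∧ ∀ θ ∈ Set.Icc θ₀ θ₁,
    klInfo F lam θ * a ≤ ∑ i ∈ Finset.range n, logLR F lam θ (X i ω)), (n : ℕ∞)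

/-- The expectation, in `[0, ∞]`, of a time `N` with values in `{0, 1, 2, …, ∞}`. -/
def expect {Ω : Type*} [MeasurableSpace Ω] (P : Measure Ω) (N : Ω → ℕ∞) : ENNReal :=
  ∫⁻ ω, (N ω : ENNReal) ∂P

/-- The probability `P(N < ∞)`. -/
def errProb {Ω : Type*} [MeasurableSpace Ω] (P : Measure Ω) (N : Ω → ℕ∞) : ℝ :=
  P.real {ω | N ω < ⊤}

end ExpFamilyTest

end

noncomputable section

namespace ExpFamilyTest

/-! ### Exponential families: moments of the tilted laws and convexity of the log-normalizer. -/

section ExponentialFamily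

variable {F : Measure ℝ} {lam θ θ' ξ : ℝ}

/-! Put `W_n = ∑_{i ≤ n} (X_i - b'(λ))` and `r_θ = (λ - θ) / I(λ, θ)`. The log-likelihood ratio
after `n` observations is `I(λ, θ) (n + r_θ W_n)`, so every competitor is judged on the same scale
`n + r_θ W_n`. Strict convexity of `b` makes `r_θ` strictly increasing in `θ`; hence the extreme
constraints are those at `θ₀` and `θ₁`, and `M(a)` is the first passage of `n + min (r₀ W_n) (r₁
W_n)` above `a`, where `r₀`, `r₁` are the values of `r_θ` at the end points.

Two changes of measure bound the error probabilities. At the time `M(a)` the likelihood ratio is at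
least `exp (I a)`, so `P_θ (M(a) < ∞) ≤ exp (-I a)` (`IsIID.errProb_le`). Conversely, Jensen's
inequality and Wald's identity give `P_θ (N < ∞) ≥ exp (-I E_λ N)` for every stopping time with
finite mean (`IsIID.exp_neg_le_errProb`). Everything thus reduces to `E_λ M(a) ≤ a + (C + o(1)) √a`.

For that bound write `min (r₀ x) (r₁ x) = r₀ x - (r₁ - r₀) x⁻`. Wald's first identity removes the
linear term, leaving `E M ≤ a + overshoot + (r₁ - r₀) E (W_M)⁻`. Fourth moments make the overshoot
`O(a ^ (1/4))`. By Wald's second identity `W_M` and `W_n`, with `n = ⌊a⌋`, differ in `L²` by `√(v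
E|M - n|)`, where `v = b''(λ)`; since `E|M - n| = O(√a)`, replacing `M` by `n` also costs `O(a ^
(1/4))` (`IsIID.exists_expect_firstPassage_le`). Finally the central limit theorem gives `E (W_n)⁻ ≤
(√(v / (2π)) + o(1)) √n`, which is where `C` comes from. All Wald identities are applied to `N ∧ m`,
with bounds uniform in `m`. -/

theorem ne_zero_of_not_ae_eq_const (hF : ∀ c : ℝ, ¬ ∀ᵐ x ∂F, x = c) : F ≠ 0 := by
  rintro rfl
  exact hF 0 (by simp)

theorem integrable_exp_of_mem_naturalParam (hξ : ξ ∈ naturalParam F) :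
    Integrable (fun x => Real.exp (ξ * id x)) F :=
  interior_subset (s := integrableExpSet id F) hξ

theorem law_eq_tilted (hF : ∀ c : ℝ, ¬ ∀ᵐ x ∂F, x = c) (hξ : ξ ∈ naturalParam F) :
    law F ξ = F.tilted (ξ * id ·) := by
  have hpos : 0 < ∫ x, Real.exp (ξ * x) ∂F :=
    mgf_pos' (X := id) (ne_zero_of_not_ae_eq_const hF) (integrable_exp_of_mem_naturalParam hξ)
  unfold law Measure.tilted
  congr 1
  ext x
  rw [density, logNorm, Real.exp_sub, Real.exp_log hpos]
  rfl

theorem isProbabilityMeasure_law (hF : ∀ c : ℝ, ¬ ∀ᵐ x ∂F, x = c) (hξ : ξ ∈ naturalParam F) :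
    IsProbabilityMeasure (law F ξ) := by
  rw [law_eq_tilted hF hξ]
  have : NeZero F := ⟨ne_zero_of_not_ae_eq_const hF⟩
  exact isProbabilityMeasure_tilted (integrable_exp_of_mem_naturalParam hξ)

theorem memLp_law (hF : ∀ c : ℝ, ¬ ∀ᵐ x ∂F, x = c) (hξ : ξ ∈ naturalParam F) (p : NNReal) :
    MemLp (fun x : ℝ => x) p (law F ξ) := by
  rw [law_eq_tilted hF hξ]
  exact memLp_tilted_mul (X := id) hξ p

theorem integral_law (hF : ∀ c : ℝ, ¬ ∀ᵐ x ∂F, x = c) (hξ : ξ ∈ naturalParam F) :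
    ∫ x, x ∂(law F ξ) = deriv (logNorm F) ξ := by
  rw [law_eq_tilted hF hξ]
  exact integral_tilted_mul_self (X := id) hξ

theorem variance_law (hF : ∀ c : ℝ, ¬ ∀ᵐ x ∂F, x = c) (hξ : ξ ∈ naturalParam F) :
    ∫ x, (x - deriv (logNorm F) ξ) ^ 2 ∂(law F ξ) = iteratedDeriv 2 (logNorm F) ξ := by
  have h := variance_tilted_mul (X := id) hξ
  have h2 := integral_law hF hξ
  rw [law_eq_tilted hF hξ] at h2 ⊢
  rw [variance_eq_integral (by fun_prop)] at h
  rw [← h2]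
  exact h

theorem law_absolutelyContinuous (hF : ∀ c : ℝ, ¬ ∀ᵐ x ∂F, x = c) (hξ : ξ ∈ naturalParam F) :
    F ≪ law F ξ := by
  rw [law_eq_tilted hF hξ]
  exact absolutelyContinuous_tilted (integrable_exp_of_mem_naturalParam hξ)

theorem iteratedDeriv_two_logNorm_pos (hF : ∀ c : ℝ, ¬ ∀ᵐ x ∂F, x = c)
    (hξ : ξ ∈ naturalParam F) : 0 < iteratedDeriv 2 (logNorm F) ξ := by
  have hprob := isProbabilityMeasure_law hF hξ
  rw [← variance_law hF hξ]
  refine lt_of_le_of_ne (integral_nonneg fun x => sq_nonneg _) fun h0 => ?_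
  have hint : Integrable (fun x : ℝ => (x - deriv (logNorm F) ξ) ^ 2) (law F ξ) :=
    ((memLp_law hF hξ 2).sub (memLp_const _)).integrable_sq
  have h := (integral_eq_zero_iff_of_nonneg (fun x => sq_nonneg _) hint).1 h0.symm
  -- Zero variance would make the tilted law a point mass, and `F` is absolutely continuous with
  -- respect to that law.
  refine hF (deriv (logNorm F) ξ) ((law_absolutelyContinuous hF hξ).ae_le ?_)
  filter_upwards [h] with x hx
  have : x - deriv (logNorm F) ξ = 0 := by simpa using hx
  linarith

theorem convex_naturalParam (F : Measure ℝ) : Convex ℝ (naturalParam F) :=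
  (convex_integrableExpSet (X := id)).interior

theorem strictConvexOn_logNorm (hF : ∀ c : ℝ, ¬ ∀ᵐ x ∂F, x = c) :
    StrictConvexOn ℝ (naturalParam F) (logNorm F) := by
  refine strictConvexOn_of_deriv2_pos' (convex_naturalParam F)
    (analyticOnNhd_cgf (X := id)).continuousOn fun x hx => ?_
  rw [← iteratedDeriv_eq_iterate]
  exact iteratedDeriv_two_logNorm_pos hF hx

theorem logLR_eq (F : Measure ℝ) (lam θ x : ℝ) :
    logLR F lam θ x = (lam - θ) * x - (logNorm F lam - logNorm F θ) := by
  rw [logLR, density, density, ← Real.exp_sub, Real.log_exp]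
  ring

theorem klInfo_eq (hF : ∀ c : ℝ, ¬ ∀ᵐ x ∂F, x = c) (hlam : lam ∈ naturalParam F) (θ : ℝ) :
    klInfo F lam θ = (lam - θ) * deriv (logNorm F) lam - (logNorm F lam - logNorm F θ) := by
  have hprob := isProbabilityMeasure_law hF hlam
  have hint : Integrable (fun x : ℝ => x) (law F lam) :=
    memLp_one_iff_integrable.1 (memLp_law hF hlam 1)
  simp_rw [klInfo, logLR_eq]
  rw [integral_sub (hint.const_mul _) (integrable_const _), integral_const_mul, integral_law hF hlam]
  simp

/-- Splitting off the mean leaves a multiple of `x - b'(λ)`, a centred variable that does not depend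
on `θ`; one random walk therefore serves all `θ`. -/
theorem logLR_eq_klInfo_add (hF : ∀ c : ℝ, ¬ ∀ᵐ x ∂F, x = c) (hlam : lam ∈ naturalParam F)
    (θ x : ℝ) :
    logLR F lam θ x = klInfo F lam θ + (lam - θ) * (x - deriv (logNorm F) lam) := by
  rw [logLR_eq, klInfo_eq hF hlam]
  ring

theorem differentiableAt_logNorm (hξ : ξ ∈ naturalParam F) :
    DifferentiableAt ℝ (logNorm F) ξ :=
  (analyticAt_cgf (X := id) hξ).differentiableAt

theorem slope_lt_deriv_logNorm (hF : ∀ c : ℝ, ¬ ∀ᵐ x ∂F, x = c) (hlam : lam ∈ naturalParam F)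
    (hθ : θ ∈ naturalParam F) (h : θ < lam) :
    slope (logNorm F) θ lam < deriv (logNorm F) lam :=
  (strictConvexOn_logNorm hF).slope_lt_of_hasDerivAt hθ hlam h
    (differentiableAt_logNorm hlam).hasDerivAt

/-- Dividing the information number by `λ - θ` leaves the gap between the tangent slope of `b` at
`λ` and the secant slope from `θ`, so sign and monotonicity in `θ` follow from strict convexity. -/
theorem div_klInfo_eq (hF : ∀ c : ℝ, ¬ ∀ᵐ x ∂F, x = c) (hlam : lam ∈ naturalParam F)
    (h : θ < lam) :
    (lam - θ) / klInfo F lam θ = (deriv (logNorm F) lam - slope (logNorm F) θ lam)⁻¹ := by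
  have h' : lam - θ ≠ 0 := by linarith
  rw [klInfo_eq hF hlam, slope_def_field, ← inv_div]
  congr 1
  field_simp

theorem klInfo_pos (hF : ∀ c : ℝ, ¬ ∀ᵐ x ∂F, x = c) (hlam : lam ∈ naturalParam F)
    (hθ : θ ∈ naturalParam F) (h : θ < lam) : 0 < klInfo F lam θ := by
  have h1 : 0 < (lam - θ) / klInfo F lam θ := by
    rw [div_klInfo_eq hF hlam h]
    exact inv_pos.2 (sub_pos.2 (slope_lt_deriv_logNorm hF hlam hθ h))
  exact (div_pos_iff_of_pos_left (sub_pos.2 h)).1 h1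

theorem div_klInfo_pos (hF : ∀ c : ℝ, ¬ ∀ᵐ x ∂F, x = c) (hlam : lam ∈ naturalParam F)
    (hθ : θ ∈ naturalParam F) (h : θ < lam) : 0 < (lam - θ) / klInfo F lam θ :=
  div_pos (sub_pos.2 h) (klInfo_pos hF hlam hθ h)

theorem div_klInfo_lt (hF : ∀ c : ℝ, ¬ ∀ᵐ x ∂F, x = c) (hlam : lam ∈ naturalParam F)
    (hθ : θ ∈ naturalParam F) (hθ' : θ' ∈ naturalParam F) (h : θ < θ') (h' : θ' < lam) :
    (lam - θ) / klInfo F lam θ < (lam - θ') / klInfo F lam θ' := by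
  rw [div_klInfo_eq hF hlam h', div_klInfo_eq hF hlam (h.trans h')]
  refine inv_strictAnti₀ (sub_pos.2 (slope_lt_deriv_logNorm hF hlam hθ' h')) ?_
  have := (strictConvexOn_logNorm hF).secant_strict_mono hlam hθ hθ' (h.trans h').ne h'.ne h
  rw [slope_comm (logNorm F) θ, slope_comm (logNorm F) θ', slope_def_field, slope_def_field]
  linarith

theorem div_klInfo_le (hF : ∀ c : ℝ, ¬ ∀ᵐ x ∂F, x = c) (hlam : lam ∈ naturalParam F)
    (hθ : θ ∈ naturalParam F) (hθ' : θ' ∈ naturalParam F) (h : θ ≤ θ') (h' : θ' < lam) :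
    (lam - θ) / klInfo F lam θ ≤ (lam - θ') / klInfo F lam θ' := by
  rcases h.eq_or_lt with rfl | h
  · exact le_rfl
  · exact (div_klInfo_lt hF hlam hθ hθ' h h').le

end ExponentialFamily

/-! ### Truncated stopping times and their survival indicators. -/

section Truncation

variable {Ω : Type*}

/-- The indicator, as a real number, that observation number `i + 1` is still taken by `N`. -/
def alive (N : Ω → ℕ∞) (i : ℕ) (ω : Ω) : ℝ := {ω | (i : ℕ∞) < N ω}.indicator 1 ω

theorem alive_of_lt {N : Ω → ℕ∞} {i : ℕ} {ω : Ω} (h : (i : ℕ∞) < N ω) : alive N i ω = 1 := by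
  simp [alive, h]

theorem alive_of_not_lt {N : Ω → ℕ∞} {i : ℕ} {ω : Ω} (h : ¬ (i : ℕ∞) < N ω) :
    alive N i ω = 0 := by
  simp [alive, h]

/-- The truncation of `N` at `m`, as a natural number. -/
def truncTime (N : Ω → ℕ∞) (m : ℕ) (ω : Ω) : ℕ := (min (N ω) m).toNat

theorem lt_truncTime_iff {N : Ω → ℕ∞} {m i : ℕ} {ω : Ω} :
    i < truncTime N m ω ↔ (i : ℕ∞) < N ω ∧ i < m := by
  have hne : min (N ω) (m : ℕ∞) ≠ ⊤ := ne_top_of_le_ne_top (ENat.natCast_ne_top m) (min_le_right _ _)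
  rw [truncTime, ← Nat.cast_lt (α := ℕ∞), ENat.natCast_toNat hne, lt_min_iff, Nat.cast_lt]

theorem truncTime_le (N : Ω → ℕ∞) (m : ℕ) (ω : Ω) : truncTime N m ω ≤ m := by
  by_contra! h
  exact lt_irrefl _ (lt_truncTime_iff.1 h).2

theorem sum_alive_mul (N : Ω → ℕ∞) (m : ℕ) (ω : Ω) (f : ℕ → ℝ) :
    ∑ i ∈ Finset.range m, alive N i ω * f i = ∑ i ∈ Finset.range (truncTime N m ω), f i := by
  have : ∀ i, alive N i ω * f i = if (i : ℕ∞) < N ω then f i else 0 := fun i => by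
    simp [alive, Set.indicator_apply]
  simp_rw [this]
  rw [← Finset.sum_filter]
  congr 1
  ext i
  simp [lt_truncTime_iff, and_comm]

theorem sum_alive (N : Ω → ℕ∞) (m : ℕ) (ω : Ω) :
    ∑ i ∈ Finset.range m, alive N i ω = truncTime N m ω := by
  simpa using sum_alive_mul N m ω 1

theorem abs_alive_le_one (N : Ω → ℕ∞) (i : ℕ) (ω : Ω) : |alive N i ω| ≤ 1 := by
  by_cases h : (i : ℕ∞) < N ω <;> simp [alive, h]

theorem alive_sq (N : Ω → ℕ∞) (i : ℕ) (ω : Ω) : alive N i ω ^ 2 = alive N i ω := by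
  by_cases h : (i : ℕ∞) < N ω <;> simp [alive, h]

theorem truncTime_natCast {n m : ℕ} (h : n ≤ m) (ω : Ω) :
    truncTime (fun _ : Ω => (n : ℕ∞)) m ω = n := by
  have : ((n : ℕ∞)) ≤ m := by exact_mod_cast h
  simp [truncTime, min_eq_left this]

end Truncation

/-! ### Wald's identities for predictable transforms of i.i.d. variables. -/

section Wald

variable {Ω : Type*} [mΩ : MeasurableSpace Ω] {X : ℕ → Ω → ℝ} {hX : ∀ i, Measurable (X i)}
  {μ : Measure Ω} {Q : Measure ℝ}

theorem measurable_obsFiltration (X : ℕ → Ω → ℝ) (hX : ∀ i, Measurable (X i)) {i n : ℕ}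
    (h : i < n) : Measurable[obsFiltration X hX n] (X i) :=
  (comap_measurable (X i)).mono
    (le_iSup₂_of_le (f := fun i (_ : i < n) => MeasurableSpace.comap (X i) inferInstance)
      i h le_rfl) le_rfl

theorem IsIID.indep_obsFiltration (h : IsIID X μ Q) (hX : ∀ i, Measurable (X i)) (n : ℕ) :
    Indep (obsFiltration X hX n) (MeasurableSpace.comap (X n) inferInstance) μ := by
  have := indep_iSup_of_disjoint (fun i => (hX i).comap_le) h.indep (S := {i | i < n}) (T := {n})
    (by simp)
  rw [iSup_singleton] at this
  exact this

theorem IsIID.integrable_comp (h : IsIID X μ Q) (hX : ∀ i, Measurable (X i)) {g : ℝ → ℝ}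
    (hg : Integrable g Q) (n : ℕ) : Integrable (fun ω => g (X n ω)) μ := by
  rw [← h.map_eq n] at hg
  exact hg.comp_measurable (hX n)

theorem IsIID.integral_comp (h : IsIID X μ Q) (hX : ∀ i, Measurable (X i)) {g : ℝ → ℝ}
    (hg : Integrable g Q) (n : ℕ) : ∫ ω, g (X n ω) ∂μ = ∫ x, g x ∂Q := by
  rw [← h.map_eq n] at hg ⊢
  exact (integral_map (hX n).aemeasurable hg.aestronglyMeasurable).symm

theorem IsIID.indepFun_past (h : IsIID X μ Q) {Z : Ω → ℝ} {g : ℝ → ℝ} {n : ℕ}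
    (hZ : Measurable[obsFiltration X hX n] Z) (hg : Measurable g) :
    IndepFun Z (fun ω => g (X n ω)) μ := by
  rw [IndepFun_iff_Indep]
  refine indep_of_indep_of_le_left (indep_of_indep_of_le_right (h.indep_obsFiltration hX n) ?_)
    hZ.comap_le
  exact (hg.comp (comap_measurable (X n))).comap_le

theorem IsIID.integrable_past_mul (h : IsIID X μ Q) {Z : Ω → ℝ} {g : ℝ → ℝ} {n : ℕ}
    (hZ : Measurable[obsFiltration X hX n] Z) (hZi : Integrable Z μ) (hg : Measurable g)
    (hgi : Integrable g Q) : Integrable (fun ω => Z ω * g (X n ω)) μ :=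
  (h.indepFun_past hZ hg).integrable_mul hZi (h.integrable_comp hX hgi n)

theorem IsIID.integral_past_mul (h : IsIID X μ Q) {Z : Ω → ℝ} {g : ℝ → ℝ} {n : ℕ}
    (hZ : Measurable[obsFiltration X hX n] Z) (hZi : Integrable Z μ) (hg : Measurable g)
    (hgi : Integrable g Q) :
    ∫ ω, Z ω * g (X n ω) ∂μ = (∫ ω, Z ω ∂μ) * ∫ x, g x ∂Q := by
  rw [← h.integral_comp hX hgi n]
  exact (h.indepFun_past hZ hg).integral_fun_mul_eq_mul_integral hZi.aestronglyMeasurable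
    (h.integrable_comp hX hgi n).aestronglyMeasurable

variable {c : ℕ → Ω → ℝ}

theorem integrable_of_predictable [IsFiniteMeasure μ]
    (hc : ∀ i, Measurable[obsFiltration X hX i] (c i))
    (hc1 : ∀ i ω, |c i ω| ≤ 1) (i : ℕ) : Integrable (c i) μ :=
  Integrable.of_bound (((hc i).mono ((obsFiltration X hX).le i) le_rfl).aestronglyMeasurable) 1
    (ae_of_all _ (hc1 i))

/-- Wald's first identity for a predictable transform with bounded coefficients. -/
theorem IsIID.integral_sum_predictable (h : IsIID X μ Q)
    (hc : ∀ i, Measurable[obsFiltration X hX i] (c i)) (hc1 : ∀ i ω, |c i ω| ≤ 1)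
    {g : ℝ → ℝ} (hg : Measurable g) (hgi : Integrable g Q) (m : ℕ) :
    Integrable (fun ω => ∑ i ∈ Finset.range m, c i ω * g (X i ω)) μ ∧
    ∫ ω, ∑ i ∈ Finset.range m, c i ω * g (X i ω) ∂μ =
      (∫ ω, ∑ i ∈ Finset.range m, c i ω ∂μ) * ∫ x, g x ∂Q := by
  have := h.isProbabilityMeasure
  have hci := integrable_of_predictable (μ := μ) hc hc1
  have hi := fun i => h.integrable_past_mul (hc i) (hci i) hg hgi
  refine ⟨integrable_finsetSum _ fun i _ => hi i, ?_⟩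
  rw [integral_finsetSum _ fun i _ => hi i, integral_finsetSum _ fun i _ => hci i, Finset.sum_mul]
  exact Finset.sum_congr rfl fun i _ => h.integral_past_mul (hc i) (hci i) hg hgi

theorem measurable_sum_predictable
    (hc : ∀ i, Measurable[obsFiltration X hX i] (c i)) {g : ℝ → ℝ} (hg : Measurable g) (m : ℕ) :
    Measurable[obsFiltration X hX m] (fun ω => ∑ i ∈ Finset.range m, c i ω * g (X i ω)) := by
  refine Finset.measurable_fun_sum (m := obsFiltration X hX m) _ fun i hi => ?_
  have hi := Finset.mem_range.1 hi
  exact ((hc i).mono ((obsFiltration X hX).mono hi.le) le_rfl).mul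
    (hg.comp (measurable_obsFiltration X hX hi))

/-- Wald's second identity for a predictable transform with bounded coefficients. -/
theorem IsIID.integral_sq_sum_predictable (h : IsIID X μ Q)
    (hc : ∀ i, Measurable[obsFiltration X hX i] (c i)) (hc1 : ∀ i ω, |c i ω| ≤ 1)
    {g : ℝ → ℝ} (hg : Measurable g) (hgi : MemLp g 2 Q) (hg0 : ∫ x, g x ∂Q = 0) (m : ℕ) :
    MemLp (fun ω => ∑ i ∈ Finset.range m, c i ω * g (X i ω)) 2 μ ∧
    ∫ ω, (∑ i ∈ Finset.range m, c i ω * g (X i ω)) ^ 2 ∂μ =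
      (∫ ω, ∑ i ∈ Finset.range m, c i ω ^ 2 ∂μ) * ∫ x, g x ^ 2 ∂Q := by
  have := h.isProbabilityMeasure
  have hQ : IsProbabilityMeasure Q := by
    rw [← h.map_eq 0]; exact Measure.isProbabilityMeasure_map (hX 0).aemeasurable
  have hg1 : Integrable g Q := hgi.integrable (by norm_num)
  have hg2 := hgi.integrable_sq
  have hc2m : ∀ i, Measurable[obsFiltration X hX i] (fun ω => c i ω ^ 2) :=
    fun i => (hc i).pow_const 2
  have hc21 : ∀ i ω, |c i ω ^ 2| ≤ 1 := fun i ω => by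
    rw [abs_pow]; exact pow_le_one₀ (abs_nonneg _) (hc1 i ω)
  have hc2 := integrable_of_predictable (μ := μ) hc2m hc21
  induction m with
  | zero => simp
  | succ m ih =>
    obtain ⟨ihL, ih⟩ := ih
    have hSm := measurable_sum_predictable (hX := hX) hc hg m
    set S := fun ω => ∑ i ∈ Finset.range m, c i ω * g (X i ω) with hS
    have hterm : MemLp (fun ω => c m ω * g (X m ω)) 2 μ := by
      have hgX : MemLp (fun ω => g (X m ω)) 2 μ := by
        rw [← h.map_eq m] at hgi
        exact hgi.comp_measurePreserving ⟨hX m, rfl⟩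
      refine hgX.of_le ?_ (ae_of_all _ fun ω => ?_)
      · exact (((hc m).mono ((obsFiltration X hX).le m) le_rfl).mul
          (hg.comp (hX m))).aestronglyMeasurable
      · rw [norm_mul]
        exact mul_le_of_le_one_left (norm_nonneg _) (hc1 m ω)
    have hSc : Integrable (fun ω => S ω * c m ω) μ := by
      refine (ihL.integrable (by norm_num)).mul_bdd (c := 1) ?_ (ae_of_all _ (hc1 m))
      exact ((hc m).mono ((obsFiltration X hX).le m) le_rfl).aestronglyMeasurable
    have hcross := h.integrable_past_mul (hSm.mul (hc m)) hSc hg hg1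
    have hcross0 := h.integral_past_mul (hSm.mul (hc m)) hSc hg hg1
    have hsq := h.integrable_past_mul (hc2m m) (hc2 m) (hg.pow_const 2) hg2
    have hsq0 := h.integral_past_mul (hc2m m) (hc2 m) (hg.pow_const 2) hg2
    simp_rw [Finset.sum_range_succ]
    refine ⟨ihL.add hterm, ?_⟩
    -- In the cross term `S ω * c m ω` depends only on the first `m` observations and `g (X m)` is
    -- centred, so it integrates to zero.
    have e : ∀ ω, (S ω + c m ω * g (X m ω)) ^ 2 =
        S ω ^ 2 + 2 * (S ω * c m ω * g (X m ω)) + c m ω ^ 2 * g (X m ω) ^ 2 := fun ω => by ring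
    change ∫ ω, (S ω + c m ω * g (X m ω)) ^ 2 ∂μ = _
    simp_rw [e]
    simp only [Pi.mul_apply] at hcross hcross0
    rw [integral_add (by exact ihL.integrable_sq.add (hcross.const_mul 2)) hsq,
      integral_add ihL.integrable_sq (hcross.const_mul 2), integral_const_mul,
      integral_add (integrable_finsetSum _ fun i _ => hc2 i) (hc2 m)]
    rw [hcross0, hsq0, hg0, ih]
    ring

theorem measurable_alive {N : Ω → ℕ∞} (hN : IsStoppingTime (obsFiltration X hX) N) (i : ℕ) :
    Measurable[obsFiltration X hX i] (alive N i) := by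
  refine Measurable.indicator (m := obsFiltration X hX i) measurable_const ?_
  exact hN.measurableSet_gt i

theorem measurable_truncTime {N : Ω → ℕ∞} (hN : IsStoppingTime (obsFiltration X hX) N) (m : ℕ) :
    Measurable (fun ω => (truncTime N m ω : ℝ)) := by
  simp_rw [← sum_alive]
  exact Finset.measurable_fun_sum _ fun i _ =>
    (measurable_alive hN i).mono ((obsFiltration X hX).le i) le_rfl

theorem integrable_truncTime [IsFiniteMeasure μ] {N : Ω → ℕ∞}
    (hN : IsStoppingTime (obsFiltration X hX) N) (m : ℕ) :
    Integrable (fun ω => (truncTime N m ω : ℝ)) μ := by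
  refine Integrable.of_bound (measurable_truncTime hN m).aestronglyMeasurable m
    (ae_of_all _ fun ω => ?_)
  simpa using truncTime_le N m ω

/-- Wald's first identity for the truncation of a stopping time. -/
theorem IsIID.integral_sum_truncTime (h : IsIID X μ Q) {N : Ω → ℕ∞}
    (hN : IsStoppingTime (obsFiltration X hX) N)
    {g : ℝ → ℝ} (hg : Measurable g) (hgi : Integrable g Q) (m : ℕ) :
    Integrable (fun ω => ∑ i ∈ Finset.range (truncTime N m ω), g (X i ω)) μ ∧
    ∫ ω, ∑ i ∈ Finset.range (truncTime N m ω), g (X i ω) ∂μ =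
      (∫ ω, (truncTime N m ω : ℝ) ∂μ) * ∫ x, g x ∂Q := by
  have := h.integral_sum_predictable (measurable_alive hN) (abs_alive_le_one N) hg hgi m
  simpa only [sum_alive_mul N m _ (fun i => g (X i _)), sum_alive] using this

/-- Wald's second identity for the truncation of a stopping time. -/
theorem IsIID.integral_sq_sum_truncTime (h : IsIID X μ Q) {N : Ω → ℕ∞}
    (hN : IsStoppingTime (obsFiltration X hX) N)
    {g : ℝ → ℝ} (hg : Measurable g) (hgi : MemLp g 2 Q) (hg0 : ∫ x, g x ∂Q = 0) (m : ℕ) :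
    MemLp (fun ω => ∑ i ∈ Finset.range (truncTime N m ω), g (X i ω)) 2 μ ∧
    ∫ ω, (∑ i ∈ Finset.range (truncTime N m ω), g (X i ω)) ^ 2 ∂μ =
      (∫ ω, (truncTime N m ω : ℝ) ∂μ) * ∫ x, g x ^ 2 ∂Q := by
  have := h.integral_sq_sum_predictable (measurable_alive hN) (abs_alive_le_one N) hg hgi hg0 m
  simpa only [sum_alive_mul N m _ (fun i => g (X i _)), sum_alive, alive_sq] using this

theorem isStoppingTime_natCast (X : ℕ → Ω → ℝ) (hX : ∀ i, Measurable (X i)) (n : ℕ) :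
    IsStoppingTime (obsFiltration X hX) (fun _ => (n : ℕ∞)) :=
  isStoppingTime_const _ n

/-- The variance of the difference between the sum stopped at a truncated stopping time and the sum
stopped at a fixed time. -/
theorem IsIID.integral_sq_sum_truncTime_sub (h : IsIID X μ Q) {N : Ω → ℕ∞}
    (hN : IsStoppingTime (obsFiltration X hX) N)
    {g : ℝ → ℝ} (hg : Measurable g) (hgi : MemLp g 2 Q) (hg0 : ∫ x, g x ∂Q = 0) {n m : ℕ}
    (hnm : n ≤ m) :
    ∫ ω, (∑ i ∈ Finset.range (truncTime N m ω), g (X i ω) -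
        ∑ i ∈ Finset.range n, g (X i ω)) ^ 2 ∂μ =
      (∫ ω, |(truncTime N m ω : ℝ) - n| ∂μ) * ∫ x, g x ^ 2 ∂Q := by
  have hn := isStoppingTime_natCast X hX n
  set n' : Ω → ℕ∞ := fun _ => (n : ℕ∞) with hn'
  -- The difference of the two stopped sums is itself a predictable transform, with coefficients in
  -- `{-1, 0, 1}`.
  have hab : ∀ i ω, |alive N i ω - alive n' i ω| ≤ 1 := fun i ω => by
    by_cases h1 : (i : ℕ∞) < N ω <;> by_cases h2 : (i : ℕ∞) < n' ω <;> simp [alive, h1, h2]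
  have key := (h.integral_sq_sum_predictable (c := fun i ω => alive N i ω - alive n' i ω)
    (fun i => (measurable_alive hN i).sub (measurable_alive hn i)) hab hg hgi hg0 m).2
  have e1 : ∀ ω, ∑ i ∈ Finset.range m, (alive N i ω - alive n' i ω) * g (X i ω) =
      ∑ i ∈ Finset.range (truncTime N m ω), g (X i ω) - ∑ i ∈ Finset.range n, g (X i ω) := by
    intro ω
    simp_rw [sub_mul]
    rw [Finset.sum_sub_distrib, sum_alive_mul N m ω (fun i => g (X i ω)),
      sum_alive_mul n' m ω (fun i => g (X i ω)), truncTime_natCast hnm]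
  -- For a given `ω` all nonzero coefficients have the same sign, decided by which time comes first,
  -- so the squares add up to the distance between the truncated times.
  have e2 : ∀ ω, ∑ i ∈ Finset.range m, (alive N i ω - alive n' i ω) ^ 2 =
      |(truncTime N m ω : ℝ) - n| := by
    intro ω
    rw [← truncTime_natCast hnm ω, ← sum_alive, ← sum_alive, ← Finset.sum_sub_distrib]
    rcases le_total (n' ω) (N ω) with hle | hle
    · have h01 : ∀ i, alive N i ω - alive n' i ω = 0 ∨ alive N i ω - alive n' i ω = 1 := fun i => by
        by_cases h2 : (i : ℕ∞) < n' ω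
        · rw [alive_of_lt h2, alive_of_lt (h2.trans_le hle)]; simp
        · rw [alive_of_not_lt h2]
          by_cases h1 : (i : ℕ∞) < N ω
          · rw [alive_of_lt h1]; simp
          · rw [alive_of_not_lt h1]; simp
      rw [abs_of_nonneg]
      · exact Finset.sum_congr rfl fun i _ => by rcases h01 i with h | h <;> rw [h] <;> norm_num
      · exact Finset.sum_nonneg fun i _ => by rcases h01 i with h | h <;> rw [h]; norm_num
    · have h01 : ∀ i, alive N i ω - alive n' i ω = 0 ∨ alive N i ω - alive n' i ω = -1 :=
        fun i => by
        by_cases h2 : (i : ℕ∞) < N ω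
        · rw [alive_of_lt h2, alive_of_lt (h2.trans_le hle)]; simp
        · rw [alive_of_not_lt h2]
          by_cases h1 : (i : ℕ∞) < n' ω
          · rw [alive_of_lt h1]; simp
          · rw [alive_of_not_lt h1]; simp
      rw [abs_of_nonpos, ← Finset.sum_neg_distrib]
      · exact Finset.sum_congr rfl fun i _ => by rcases h01 i with h | h <;> rw [h] <;> norm_num
      · exact Finset.sum_nonpos fun i _ => by rcases h01 i with h | h <;> rw [h]; norm_num
  simp_rw [e1, e2] at key
  exact key

end Wald

/-! ### Decomposition of `{N < ∞}` by the value of `N`. -/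

section Partition

variable {Ω : Type*}

theorem setOf_lt_top_eq_iUnion (N : Ω → ℕ∞) : {ω | N ω < ⊤} = ⋃ n : ℕ, {ω | N ω = n} := by
  ext ω
  simp only [Set.mem_ofPred_eq, Set.mem_iUnion, lt_top_iff_ne_top, ENat.ne_top_iff_exists]
  exact ⟨fun ⟨n, hn⟩ => ⟨n, hn.symm⟩, fun ⟨n, hn⟩ => ⟨n, hn.symm⟩⟩

theorem pairwise_disjoint_setOf_eq (N : Ω → ℕ∞) :
    Pairwise (Function.onFun Disjoint fun n : ℕ => {ω | N ω = n}) := by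
  intro i j hij
  refine Set.disjoint_left.2 fun ω hi hj => hij ?_
  simp only [Set.mem_ofPred_eq] at hi hj
  exact_mod_cast hi.symm.trans hj

end Partition

/-! ### Change of measure for the observed variables. -/

section ChangeOfMeasure

variable {Ω : Type*} [mΩ : MeasurableSpace Ω] {X : ℕ → Ω → ℝ} {hX : ∀ i, Measurable (X i)}
  {μ ν : Measure Ω} {Q R : Measure ℝ}

/-- Every event observable at time `n` is thus a preimage of a Borel set of `ℝⁿ`, so a change of
measure need only be proved for the law of the first `n` observations. -/
theorem obsFiltration_eq_comap (X : ℕ → Ω → ℝ) (hX : ∀ i, Measurable (X i)) (n : ℕ) :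
    obsFiltration X hX n =
      MeasurableSpace.comap (fun ω (i : Fin n) => X i ω) MeasurableSpace.pi := by
  change (⨆ (i : ℕ) (_ : i < n), MeasurableSpace.comap (X i) inferInstance) = _
  rw [MeasurableSpace.pi, MeasurableSpace.comap_iSup]
  simp_rw [MeasurableSpace.comap_comp]
  refine le_antisymm (iSup₂_le fun i hi => ?_) (iSup_le fun i => ?_)
  · exact le_iSup_of_le (⟨i, hi⟩ : Fin n) le_rfl
  · exact le_iSup₂_of_le (f := fun i (_ : i < n) => MeasurableSpace.comap (X i) inferInstance)
      i.1 i.2 le_rfl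

theorem IsIID.isProbabilityMeasure_law (h : IsIID X μ Q) (hX : ∀ i, Measurable (X i)) :
    IsProbabilityMeasure Q := by
  have := h.isProbabilityMeasure
  rw [← h.map_eq 0]
  exact Measure.isProbabilityMeasure_map (hX 0).aemeasurable

theorem IsIID.map_eq_pi (h : IsIID X μ Q) (hX : ∀ i, Measurable (X i)) (n : ℕ) :
    μ.map (fun ω (i : Fin n) => X i ω) = Measure.pi fun _ => Q := by
  have := h.isProbabilityMeasure
  have hi : iIndepFun (fun i : Fin n => X i) μ := h.indep.precomp Fin.val_injective
  rw [iIndepFun.map_fun_eq_pi_map (f := fun i : Fin n => X i) (fun i => (hX i).aemeasurable) hi]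
  simp_rw [h.map_eq]

/-- A product measure is determined by its values on boxes, and on a box independence factors the
integral of the product density. -/
theorem IsIID.map_withDensity_eq_pi (h : IsIID X μ Q) (hX : ∀ i, Measurable (X i))
    {g : ℝ → ENNReal} (hg : Measurable g) [IsProbabilityMeasure (Q.withDensity g)] (n : ℕ) :
    (μ.withDensity fun ω => ∏ i : Fin n, g (X i ω)).map (fun ω (i : Fin n) => X i ω) =
      Measure.pi fun _ => Q.withDensity g := by
  have hY : Measurable (fun ω (i : Fin n) => X i ω) := measurable_pi_lambda _ fun i => hX i
  have hi : iIndepFun (fun i : Fin n => X i) μ := h.indep.precomp Fin.val_injective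
  refine (Measure.pi_eq fun s hs => ?_).symm
  have hbox : MeasurableSet (Set.univ.pi s) := MeasurableSet.univ_pi hs
  have hgs : ∀ i, Measurable ((s i).indicator g) := fun i => hg.indicator (hs i)
  rw [Measure.map_apply hY hbox, withDensity_apply _ (hY hbox), ← lintegral_indicator (hY hbox)]
  have e : ∀ ω, ((fun ω (i : Fin n) => X i ω) ⁻¹' Set.univ.pi s).indicator
      (fun ω => ∏ i : Fin n, g (X i ω)) ω = ∏ i : Fin n, (s i).indicator g (X i ω) := by
    intro ω
    by_cases hω : ∀ i : Fin n, X i ω ∈ s i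
    · rw [Set.indicator_of_mem (by simpa using hω)]
      exact Finset.prod_congr rfl fun i _ => (Set.indicator_of_mem (hω i) g).symm
    · rw [Set.indicator_of_notMem (by simpa using hω)]
      push Not at hω
      obtain ⟨i, hi⟩ := hω
      exact (Finset.prod_eq_zero (Finset.mem_univ i) (Set.indicator_of_notMem hi g)).symm
  simp_rw [e]
  rw [lintegral_prod_eq_prod_lintegral_of_indepFun Finset.univ
    (fun i ω => (s i).indicator g (X i ω)) (hi.comp _ hgs) fun i => (hgs i).comp (hX i)]
  refine Finset.prod_congr rfl fun i _ => ?_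
  rw [withDensity_apply _ (hs i), ← lintegral_indicator (hs i), ← h.map_eq i,
    lintegral_map (hgs i) (hX i)]

/-- Change of measure on the observations up to time `n`. -/
theorem IsIID.measure_eq_setLIntegral (h : IsIID X μ Q) (hX : ∀ i, Measurable (X i))
    {g : ℝ → ENNReal} (hg : Measurable g) (h' : IsIID X ν (Q.withDensity g)) {n : ℕ} {A : Set Ω}
    (hA : MeasurableSet[obsFiltration X hX n] A) :
    ν A = ∫⁻ ω in A, ∏ i ∈ Finset.range n, g (X i ω) ∂μ := by
  have := h'.isProbabilityMeasure_law hX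
  have hY : Measurable (fun ω (i : Fin n) => X i ω) := measurable_pi_lambda _ fun i => hX i
  rw [obsFiltration_eq_comap] at hA
  obtain ⟨B, hB, rfl⟩ := hA
  have key := (h'.map_eq_pi hX n).trans (h.map_withDensity_eq_pi hX hg n).symm
  have := congrArg (fun κ => κ B) key
  rw [Measure.map_apply hY hB, Measure.map_apply hY hB, withDensity_apply _ (hY hB)] at this
  simp_rw [this, Finset.prod_range]

/-- Change of measure with a density given by a real log-likelihood ratio `l`. -/
theorem IsIID.measureReal_eq_setIntegral (h : IsIID X μ Q) (hX : ∀ i, Measurable (X i))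
    {l : ℝ → ℝ} (hl : Measurable l)
    (h' : IsIID X ν (Q.withDensity fun x => ENNReal.ofReal (Real.exp (-l x)))) (n : ℕ) :
    Integrable (fun ω => Real.exp (-∑ i ∈ Finset.range n, l (X i ω))) μ ∧
    ∀ A : Set Ω, MeasurableSet[obsFiltration X hX n] A →
      ν.real A = ∫ ω in A, Real.exp (-∑ i ∈ Finset.range n, l (X i ω)) ∂μ := by
  have := h'.isProbabilityMeasure
  have hg : Measurable fun x => ENNReal.ofReal (Real.exp (-l x)) := by fun_prop
  have e : ∀ ω, ∏ i ∈ Finset.range n, ENNReal.ofReal (Real.exp (-l (X i ω))) =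
      ENNReal.ofReal (Real.exp (-∑ i ∈ Finset.range n, l (X i ω))) := fun ω => by
    rw [← ENNReal.ofReal_prod_of_nonneg fun i _ => (Real.exp_pos _).le, ← Real.exp_sum,
      Finset.sum_neg_distrib]
  have key : ∀ A : Set Ω, MeasurableSet[obsFiltration X hX n] A →
      ν A = ∫⁻ ω in A, ENNReal.ofReal (Real.exp (-∑ i ∈ Finset.range n, l (X i ω))) ∂μ :=
    fun A hA => by
      rw [h.measure_eq_setLIntegral hX hg h' hA]
      simp_rw [e]
  have hm : Measurable fun ω => Real.exp (-∑ i ∈ Finset.range n, l (X i ω)) := by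
    have := fun i => hl.comp (hX i)
    simp only [Function.comp_def] at this
    exact (Finset.measurable_fun_sum _ fun i _ => this i).neg.exp
  refine ⟨⟨hm.aestronglyMeasurable, ?_⟩, fun A hA => ?_⟩
  · rw [hasFiniteIntegral_iff_ofReal (ae_of_all _ fun ω => (Real.exp_pos _).le)]
    have := key Set.univ MeasurableSet.univ
    rw [Measure.restrict_univ, measure_univ] at this
    rw [← this]
    exact ENNReal.one_lt_top
  · rw [integral_eq_lintegral_of_nonneg_ae (ae_of_all _ fun ω => (Real.exp_pos _).le)
      hm.aestronglyMeasurable, ← key A hA]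
    rfl

theorem measurableSet_eq_natCast {N : Ω → ℕ∞} (hN : IsStoppingTime (obsFiltration X hX) N)
    (n : ℕ) : MeasurableSet[obsFiltration X hX n] {ω | N ω = n} :=
  hN.measurableSet_eq n

/-- If the log-likelihood ratio is at least `b` when `N` stops, then `ν (N < ∞) ≤ exp (-b)`. -/
theorem IsIID.errProb_le (h : IsIID X μ Q) {l : ℝ → ℝ} (hl : Measurable l)
    (h' : IsIID X ν (Q.withDensity fun x => ENNReal.ofReal (Real.exp (-l x))))
    {N : Ω → ℕ∞} (hN : IsStoppingTime (obsFiltration X hX) N) {b : ℝ}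
    (hb : ∀ (n : ℕ) ω, N ω = n → b ≤ ∑ i ∈ Finset.range n, l (X i ω)) :
    errProb ν N ≤ Real.exp (-b) := by
  have := h.isProbabilityMeasure
  have := h'.isProbabilityMeasure
  have hm : ∀ n : ℕ, MeasurableSet {ω | N ω = n} := fun n =>
    (obsFiltration X hX).le n _ (measurableSet_eq_natCast hN n)
  have key : ∀ n : ℕ, ν {ω | N ω = n} ≤ ENNReal.ofReal (Real.exp (-b)) * μ {ω | N ω = n} := by
    intro n
    obtain ⟨hi, hc⟩ := h.measureReal_eq_setIntegral hX hl h' n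
    rw [← ofReal_measureReal (μ := ν), ← ofReal_measureReal (μ := μ),
      ← ENNReal.ofReal_mul (Real.exp_pos _).le, hc _ (measurableSet_eq_natCast hN n)]
    refine ENNReal.ofReal_le_ofReal ?_
    calc ∫ ω in {ω | N ω = n}, Real.exp (-∑ i ∈ Finset.range n, l (X i ω)) ∂μ
        ≤ ∫ ω in {ω | N ω = n}, Real.exp (-b) ∂μ := by
          refine setIntegral_mono_on hi.integrableOn (integrable_const _).integrableOn (hm n)
            fun ω hω => ?_
          exact Real.exp_le_exp.2 (neg_le_neg (hb n ω hω))
      _ = Real.exp (-b) * μ.real {ω | N ω = n} := by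
          rw [setIntegral_const, smul_eq_mul, mul_comm]
  rw [errProb, measureReal_def]
  refine ENNReal.toReal_le_of_le_ofReal (Real.exp_pos _).le ?_
  rw [setOf_lt_top_eq_iUnion, measure_iUnion (pairwise_disjoint_setOf_eq N) hm]
  calc ∑' n : ℕ, ν {ω | N ω = n} ≤ ∑' n : ℕ, ENNReal.ofReal (Real.exp (-b)) * μ {ω | N ω = n} :=
        ENNReal.tsum_le_tsum key
    _ = ENNReal.ofReal (Real.exp (-b)) * μ (⋃ n : ℕ, {ω | N ω = n}) := by
        rw [ENNReal.tsum_mul_left, measure_iUnion (pairwise_disjoint_setOf_eq N) hm]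
    _ ≤ ENNReal.ofReal (Real.exp (-b)) * 1 := by gcongr; exact prob_le_one
    _ = _ := mul_one _

end ChangeOfMeasure

/-! ### Limits along truncations and the lower bound for error probabilities. -/

section TruncatedExpectation

variable {Ω : Type*} [mΩ : MeasurableSpace Ω] {X : ℕ → Ω → ℝ} {hX : ∀ i, Measurable (X i)}
  {μ ν : Measure Ω} {Q : Measure ℝ} {N : Ω → ℕ∞}

omit mΩ in
theorem truncTime_toENNReal (N : Ω → ℕ∞) (m : ℕ) (ω : Ω) :
    (truncTime N m ω : ENNReal) = min (N ω : ENNReal) m := by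
  have hne : min (N ω) (m : ℕ∞) ≠ ⊤ :=
    ne_top_of_le_ne_top (ENat.natCast_ne_top m) (min_le_right _ _)
  have := congrArg (ENat.toENNReal) (ENat.natCast_toNat hne)
  rw [ENat.toENNReal_min, ENat.toENNReal_coe, ENat.toENNReal_coe] at this
  exact this

omit mΩ in
theorem iSup_truncTime (N : Ω → ℕ∞) (ω : Ω) :
    ⨆ m : ℕ, (truncTime N m ω : ENNReal) = (N ω : ENNReal) := by
  simp_rw [truncTime_toENNReal, ← inf_iSup_eq, ENNReal.iSup_natCast]
  simp

theorem lintegral_truncTime [IsFiniteMeasure μ] (hN : IsStoppingTime (obsFiltration X hX) N)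
    (m : ℕ) :
    ∫⁻ ω, (truncTime N m ω : ENNReal) ∂μ = ENNReal.ofReal (∫ ω, (truncTime N m ω : ℝ) ∂μ) := by
  rw [ofReal_integral_eq_lintegral_ofReal (integrable_truncTime hN m)
    (ae_of_all _ fun ω => Nat.cast_nonneg _)]
  simp

theorem measurable_truncTime_toENNReal (hN : IsStoppingTime (obsFiltration X hX) N) (m : ℕ) :
    Measurable (fun ω => (truncTime N m ω : ENNReal)) := by
  have := (measurable_truncTime hN m).ennreal_ofReal
  simpa using this

theorem expect_eq_iSup (hN : IsStoppingTime (obsFiltration X hX) N) :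
    expect μ N = ⨆ m : ℕ, ∫⁻ ω, (truncTime N m ω : ENNReal) ∂μ := by
  rw [← lintegral_iSup (measurable_truncTime_toENNReal hN), expect]
  · simp_rw [iSup_truncTime]
  · intro i j hij ω
    simp only [truncTime_toENNReal]
    exact min_le_min_left _ (by exact_mod_cast hij)

theorem integral_truncTime_le [IsFiniteMeasure μ] (hN : IsStoppingTime (obsFiltration X hX) N)
    (hfin : expect μ N ≠ ⊤) (m : ℕ) :
    ∫ ω, (truncTime N m ω : ℝ) ∂μ ≤ (expect μ N).toReal := by
  rw [← ENNReal.ofReal_le_iff_le_toReal hfin, ← lintegral_truncTime hN, expect_eq_iSup hN]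
  exact le_iSup (fun m : ℕ => ∫⁻ ω, (truncTime N m ω : ENNReal) ∂μ) m

theorem expect_le_of_forall_integral_truncTime_le [IsFiniteMeasure μ]
    (hN : IsStoppingTime (obsFiltration X hX) N) {B : ℝ} (m₀ : ℕ)
    (hB : ∀ m, m₀ ≤ m → ∫ ω, (truncTime N m ω : ℝ) ∂μ ≤ B) :
    expect μ N ≤ ENNReal.ofReal B := by
  rw [expect_eq_iSup hN]
  refine iSup_le fun m => ?_
  refine le_trans (lintegral_mono fun ω => ?_) ((lintegral_truncTime hN (max m m₀)).trans_le
    (ENNReal.ofReal_le_ofReal (hB _ (le_max_right _ _))))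
  rw [truncTime_toENNReal, truncTime_toENNReal]
  exact min_le_min_left _ (by exact_mod_cast le_max_left m m₀)

theorem measurableSet_le_natCast (hN : IsStoppingTime (obsFiltration X hX) N) (m : ℕ) :
    MeasurableSet {ω | N ω ≤ m} :=
  (obsFiltration X hX).le m _ (hN m)

/-- Markov's inequality for the truncated time, which equals `m` on `{N > m}`. -/
theorem measureReal_natCast_lt_mul_le [IsFiniteMeasure μ]
    (hN : IsStoppingTime (obsFiltration X hX) N) (hfin : expect μ N ≠ ⊤) (m : ℕ) :
    (m : ℝ) * μ.real {ω | N ω ≤ m}ᶜ ≤ (expect μ N).toReal := by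
  refine le_trans ?_ (integral_truncTime_le hN hfin m)
  rw [mul_comm, ← smul_eq_mul, ← integral_indicator_const _ (measurableSet_le_natCast hN m).compl]
  refine integral_mono ((integrable_const _).indicator (measurableSet_le_natCast hN m).compl)
    (integrable_truncTime hN m) fun ω => ?_
  refine Set.indicator_le' (fun ω hω => ?_) (fun ω _ => Nat.cast_nonneg _) ω
  have hω : (m : ℕ∞) < N ω := by simpa using hω
  have : truncTime N m ω = m := by simp [truncTime, min_eq_right hω.le]
  simp [this]

omit mΩ in
theorem truncTime_eq_of_eq {m n : ℕ} {ω : Ω} (h : N ω = n) (hnm : n ≤ m) :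
    truncTime N m ω = n := by
  have : (n : ℕ∞) ≤ m := by exact_mod_cast hnm
  simp [truncTime, h, min_eq_left this]

omit mΩ in
theorem setOf_le_natCast_eq_biUnion (N : Ω → ℕ∞) (m : ℕ) :
    {ω | N ω ≤ m} = ⋃ n ∈ Finset.range (m + 1), {ω | N ω = n} := by
  ext ω
  simp only [Set.mem_ofPred_eq, Set.mem_iUnion, Finset.mem_range, exists_prop]
  constructor
  · intro h
    obtain ⟨n, hn⟩ := ENat.ne_top_iff_exists.1 (ne_top_of_le_ne_top (ENat.natCast_ne_top m) h)
    rw [← hn] at h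
    exact ⟨n, Nat.lt_succ_of_le (by exact_mod_cast h), hn.symm⟩
  · rintro ⟨n, hn, h⟩
    rw [h]
    exact_mod_cast Nat.le_of_lt_succ hn

/-- A lower bound for `ν (N ≤ m)` from the tangent line of the exponential at `-c`. -/
theorem IsIID.exp_mul_setIntegral_le (h : IsIID X μ Q) {l : ℝ → ℝ} (hl : Measurable l)
    (hli : Integrable l Q)
    (h' : IsIID X ν (Q.withDensity fun x => ENNReal.ofReal (Real.exp (-l x))))
    (hN : IsStoppingTime (obsFiltration X hX) N) (c : ℝ) (m : ℕ) :
    Real.exp (-c) * ∫ ω in {ω | N ω ≤ m},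
      (1 + c - ∑ i ∈ Finset.range (truncTime N m ω), l (X i ω)) ∂μ ≤ ν.real {ω | N ω ≤ m} := by
  have := h.isProbabilityMeasure
  have := h'.isProbabilityMeasure
  have hm : ∀ n : ℕ, MeasurableSet {ω | N ω = n} := fun n =>
    (obsFiltration X hX).le n _ (measurableSet_eq_natCast hN n)
  have hd : Set.PairwiseDisjoint (Finset.range (m + 1) : Set ℕ) fun n : ℕ => {ω | N ω = n} :=
    fun i _ j _ hij => pairwise_disjoint_setOf_eq N hij
  have hint : Integrable (fun ω => 1 + c - ∑ i ∈ Finset.range (truncTime N m ω), l (X i ω)) μ :=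
    (integrable_const _).sub (h.integral_sum_truncTime hN hl hli m).1
  rw [setOf_le_natCast_eq_biUnion, measureReal_biUnion_finset hd fun n _ => hm n,
    integral_biUnion_finset _ (fun n _ => hm n) hd fun n _ => hint.integrableOn, Finset.mul_sum]
  refine Finset.sum_le_sum fun n hn => ?_
  have hn := Nat.le_of_lt_succ (Finset.mem_range.1 hn)
  obtain ⟨hi, hc⟩ := h.measureReal_eq_setIntegral hX hl h' n
  rw [hc _ (measurableSet_eq_natCast hN n), ← integral_const_mul]
  refine setIntegral_mono_on (hint.const_mul _).integrableOn hi.integrableOn (hm n) fun ω hω => ?_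
  rw [truncTime_eq_of_eq hω hn]
  set L := ∑ i ∈ Finset.range n, l (X i ω)
  have h1 := Real.add_one_le_exp (c - L)
  calc Real.exp (-c) * (1 + c - L) ≤ Real.exp (-c) * Real.exp (c - L) := by
        gcongr; linarith
    _ = Real.exp (-L) := by rw [← Real.exp_add]; congr 1; ring

/-- If the mean of the log-likelihood ratio of one observation is `κ`, then
`ν (N < ∞) ≥ exp (-κ E N)`. -/
theorem IsIID.exp_neg_le_errProb (h : IsIID X μ Q) {w : ℝ → ℝ} (hw : Measurable w)
    (hw2 : MemLp w 2 Q) (hw0 : ∫ x, w x ∂Q = 0) {κ : ℝ} (hκ : 0 ≤ κ)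
    (h' : IsIID X ν (Q.withDensity fun x => ENNReal.ofReal (Real.exp (-(κ + w x)))))
    (hN : IsStoppingTime (obsFiltration X hX) N) (hfin : expect μ N ≠ ⊤) :
    Real.exp (-(κ * (expect μ N).toReal)) ≤ errProb ν N := by
  have := h.isProbabilityMeasure
  have := h'.isProbabilityMeasure
  have hQ := h.isProbabilityMeasure_law hX
  set E := (expect μ N).toReal with hE
  -- The tangent point is the mean log-likelihood ratio at time `N`; there the tangent-line bound
  -- has mean tending to `1`, which reproduces Jensen's inequality. The other terms in `key` are
  -- truncation errors vanishing as `m → ∞`.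
  set c := κ * E with hcdef
  set v := ∫ x, w x ^ 2 ∂Q with hv
  have hv0 : 0 ≤ v := integral_nonneg fun x => sq_nonneg _
  have hE0 : 0 ≤ E := ENNReal.toReal_nonneg
  have hwi : Integrable w Q := hw2.integrable (by norm_num)
  have hli : Integrable (fun x => κ + w x) Q := (integrable_const κ).add hwi
  have key : ∀ m : ℕ, 0 < m → Real.exp (-c) *
      (1 - (1 + c) * E * (m : ℝ)⁻¹ - v * E * (√m)⁻¹ - E * (√m)⁻¹) ≤ errProb ν N := by
    intro m hm0
    have hmp : (0 : ℝ) < m := by exact_mod_cast hm0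
    have hsm : 0 < √(m : ℝ) := Real.sqrt_pos.2 hmp
    have hA := measurableSet_le_natCast hN m
    have hstep := h.exp_mul_setIntegral_le (by fun_prop) hli h' hN c m
    have hmono : ν.real {ω | N ω ≤ m} ≤ errProb ν N :=
      measureReal_mono fun ω hω => lt_of_le_of_lt hω (ENat.natCast_lt_top m)
    refine le_trans (le_trans ?_ hstep) hmono
    refine mul_le_mul_of_nonneg_left ?_ (Real.exp_pos _).le
    set A := {ω | N ω ≤ m} with hAdef
    set W := fun ω => ∑ i ∈ Finset.range (truncTime N m ω), w (X i ω) with hW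
    obtain ⟨hWL, hWsq⟩ := h.integral_sq_sum_truncTime hN hw hw2 hw0 m
    obtain ⟨hWi, hW0⟩ := h.integral_sum_truncTime hN hw hwi m
    have hTi := integrable_truncTime (μ := μ) hN m
    set t := ∫ ω, (truncTime N m ω : ℝ) ∂μ with ht
    have htE : t ≤ E := integral_truncTime_le hN hfin m
    have ht0 : 0 ≤ t := integral_nonneg fun ω => Nat.cast_nonneg _
    have hp := measureReal_natCast_lt_mul_le (μ := μ) hN hfin m
    rw [← hAdef] at hp
    have hpA : μ.real A = 1 - μ.real Aᶜ := by
      rw [measureReal_compl hA]; simp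
    have hp0 : 0 ≤ μ.real Aᶜ := measureReal_nonneg
    have esum : ∀ ω, 1 + c - ∑ i ∈ Finset.range (truncTime N m ω), (κ + w (X i ω)) =
        (1 + c) - κ * truncTime N m ω - W ω := fun ω => by
      rw [Finset.sum_add_distrib]; simp only [hW, Finset.sum_const, Finset.card_range, nsmul_eq_mul]
      ring
    simp_rw [esum]
    have i1 : Integrable (fun ω => (1 + c) - κ * truncTime N m ω) μ :=
      (integrable_const _).sub (hTi.const_mul κ)
    rw [integral_sub i1.integrableOn hWi.integrableOn,
      integral_sub (integrable_const _).integrableOn (hTi.const_mul κ).integrableOn,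
      setIntegral_const, smul_eq_mul, integral_const_mul]
    have hT1 : ∫ ω in A, (truncTime N m ω : ℝ) ∂μ ≤ t :=
      setIntegral_le_integral hTi (ae_of_all _ fun ω => Nat.cast_nonneg _)
    -- The stopped sum is centred, so its integral over `{N ≤ m}` can be traded for one over the
    -- rare event `{N > m}`.
    have hsplit : ∫ ω in A, W ω ∂μ = - ∫ ω in Aᶜ, W ω ∂μ := by
      have := integral_add_compl hA hWi
      rw [hW0, hw0, mul_zero] at this
      simp only [hW]
      linarith
    have hWA : -(v * t * (√m)⁻¹ + μ.real Aᶜ * √m) ≤ ∫ ω in Aᶜ, W ω ∂μ := by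
      have i2 : Integrable (fun ω => W ω ^ 2 * (√m)⁻¹) μ := hWL.integrable_sq.mul_const _
      calc -(v * t * (√m)⁻¹ + μ.real Aᶜ * √m)
          ≤ -(∫ ω in Aᶜ, W ω ^ 2 * (√m)⁻¹ ∂μ + μ.real Aᶜ * √m) := by
            have : ∫ ω in Aᶜ, W ω ^ 2 * (√m)⁻¹ ∂μ ≤ ∫ ω, W ω ^ 2 * (√m)⁻¹ ∂μ :=
              setIntegral_le_integral i2 (ae_of_all _ fun ω => by positivity)
            rw [integral_mul_const (μ := μ), hWsq] at this
            linarith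
        _ = ∫ ω in Aᶜ, -(W ω ^ 2 * (√m)⁻¹ + √m) ∂μ := by
            rw [integral_neg, integral_add i2.integrableOn (integrable_const _).integrableOn,
              setIntegral_const, smul_eq_mul]
        _ ≤ ∫ ω in Aᶜ, W ω ∂μ := by
            refine integral_mono (i2.add (integrable_const _)).neg.integrableOn
              hWi.integrableOn fun ω => ?_
            -- This square yields `-W ≤ W² / √m + √m`: the first part is controlled by Wald's second
            -- identity, the second by the Markov bound on `{N > m}`.
            have : 0 ≤ (W ω + √m) ^ 2 * (√m)⁻¹ := by positivity
            have e : (W ω + √m) ^ 2 * (√m)⁻¹ = W ω ^ 2 * (√m)⁻¹ + √m + 2 * W ω := by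
              field_simp; ring
            have : 0 ≤ W ω ^ 2 * (√m)⁻¹ + √m := by positivity
            simp only []
            linarith
    have hpm : μ.real Aᶜ ≤ E * (m : ℝ)⁻¹ := by
      rw [← div_eq_mul_inv, le_div_iff₀ hmp]; linarith
    have hpm2 : μ.real Aᶜ * √m ≤ E * (√m)⁻¹ := by
      calc μ.real Aᶜ * √m ≤ E * (m : ℝ)⁻¹ * √m := by gcongr
        _ = E * (√m)⁻¹ := by
          have : (m : ℝ) = √m * √m := (Real.mul_self_sqrt hmp.le).symm
          rw [this]; simp only [Real.sqrt_mul_self hsm.le]; field_simp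
    have h1 : κ * ∫ ω in A, (truncTime N m ω : ℝ) ∂μ ≤ c :=
      mul_le_mul_of_nonneg_left (hT1.trans htE) hκ
    have h2 : (1 + c) * μ.real Aᶜ ≤ (1 + c) * E * (m : ℝ)⁻¹ := by
      rw [mul_assoc]; gcongr
    have h3 : v * t * (√m)⁻¹ ≤ v * E * (√m)⁻¹ := by gcongr
    rw [hsplit, hpA]
    linarith
  have hlim1 : Tendsto (fun m : ℕ => (m : ℝ)⁻¹) atTop (𝓝 0) := tendsto_inv_atTop_nhds_zero_nat
  have hlim2 : Tendsto (fun m : ℕ => (√(m : ℝ))⁻¹) atTop (𝓝 0) :=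
    tendsto_inv_atTop_zero.comp (Real.tendsto_sqrt_atTop.comp tendsto_natCast_atTop_atTop)
  have hlim : Tendsto (fun m : ℕ => Real.exp (-c) *
      (1 - (1 + c) * E * (m : ℝ)⁻¹ - v * E * (√m)⁻¹ - E * (√m)⁻¹)) atTop
      (𝓝 (Real.exp (-c) * (1 - (1 + c) * E * 0 - v * E * 0 - E * 0))) :=
    (((tendsto_const_nhds.sub (hlim1.const_mul _)).sub (hlim2.const_mul _)).sub
      (hlim2.const_mul _)).const_mul _
  simp only [mul_zero, sub_zero, mul_one] at hlim
  exact le_of_tendsto hlim (eventually_atTop.2 ⟨1, fun m hm => key m hm⟩)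

end TruncatedExpectation

/-! ### Deterministic inequalities behind the sample-size bounds. -/

section Inequalities

theorem min_mul_eq {r₀ r₁ : ℝ} (hr : r₀ ≤ r₁) (x : ℝ) :
    min (r₀ * x) (r₁ * x) = r₀ * x - (r₁ - r₀) * max (-x) 0 := by
  rcases le_total 0 x with h | h
  · rw [min_eq_left (mul_le_mul_of_nonneg_right hr h), max_eq_right (neg_nonpos.2 h)]; ring
  · rw [min_eq_right (mul_le_mul_of_nonpos_right hr h), max_eq_left (neg_nonneg.2 h)]; ring

theorem min_mul_add_le {r₀ r₁ : ℝ} (h₀ : 0 ≤ r₀) (hr : r₀ ≤ r₁) (x y : ℝ) :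
    min (r₀ * (x + y)) (r₁ * (x + y)) ≤ min (r₀ * x) (r₁ * x) + r₁ * |y| := by
  have h1 : r₁ * y ≤ r₁ * |y| := mul_le_mul_of_nonneg_left (le_abs_self y) (h₀.trans hr)
  have h2 : r₀ * y ≤ r₁ * |y| :=
    (mul_le_mul_of_nonneg_left (le_abs_self y) h₀).trans
      (mul_le_mul_of_nonneg_right hr (abs_nonneg y))
  rcases min_choice (r₀ * x) (r₁ * x) with h | h <;> rw [h]
  · exact (min_le_left _ _).trans (by linarith)
  · exact (min_le_right _ _).trans (by linarith)

/-- Controls the last jump before stopping. Bounding its fourth power by the sum of all of them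
makes Wald's identity applicable, and `s` is free to be optimized. -/
theorem abs_le_add_pow_four_div (x : ℝ) {s : ℝ} (hs : 0 < s) : |x| ≤ s + x ^ 4 / s ^ 3 := by
  rcases le_total |x| s with h | h
  · have : 0 ≤ x ^ 4 / s ^ 3 := by positivity
    linarith
  · have h1 : |x| ≤ x ^ 4 / s ^ 3 := by
      rw [le_div_iff₀ (by positivity)]
      calc |x| * s ^ 3 ≤ |x| * |x| ^ 3 := by gcongr
        _ = |x| ^ 4 := by ring
        _ = x ^ 4 := by rw [Even.pow_abs (by decide)]
    linarith

/-- The a priori bound on the expected sample size. -/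
theorem le_two_mul_add_of_le {a t e v k D R : ℝ} (ht : 0 ≤ t) (hv : 0 ≤ v) (hk : 0 ≤ k)
    (hD : 0 ≤ D) (hR : 0 ≤ R)
    (h1 : ∀ s : ℝ, 0 < s → t ≤ a + 1 + R * (s + k * t / s ^ 3) + D * e) (h2 : e ≤ √(v * t)) :
    t ≤ 2 * a + 2 * (1 + R * (4 * R * k + 1) + D ^ 2 * v) := by
  -- Chosen so that the overshoot term contributes at most `t / 4`; the term `D * e` contributes
  -- another `t / 4`, and both are absorbed on the left.
  set s := 4 * R * k + 1 with hs
  have hs1 : 1 ≤ s := by have : 0 ≤ 4 * R * k := by positivity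
                         linarith
  have hs0 : 0 < s := by linarith
  have h3 := h1 s hs0
  have h4 : R * (k * t / s ^ 3) ≤ t / 4 := by
    rw [← mul_div_assoc, div_le_div_iff₀ (by positivity) (by norm_num)]
    have : s ≤ s ^ 3 := le_self_pow₀ hs1 (by norm_num)
    have : R * (k * t) * 4 ≤ s * t := by rw [hs]; nlinarith
    nlinarith
  have h5 : D * e ≤ t / 4 + D ^ 2 * v := by
    have h6 : D * e ≤ D * √(v * t) := by gcongr
    have h7 : D * √(v * t) = (D * √v) * √t := by rw [Real.sqrt_mul hv]; ring
    nlinarith [sq_nonneg (D * √v - √t / 2), Real.sq_sqrt hv, Real.sq_sqrt ht]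
  rw [mul_add] at h3
  linarith

/-- The refined bound on the expected sample size. -/
theorem exists_le_add_mul_of_le {v k D R r : ℝ} (hv : 0 ≤ v) (hk : 0 ≤ k)
    (hD : 0 ≤ D) (hR : 0 ≤ R) (hr : 0 ≤ r) :
    ∃ K : ℝ, ∀ α t e e' q n : ℝ, 1 ≤ α → 0 ≤ t → 0 ≤ q → α ^ 4 ≤ n + 1 →
      (∀ s : ℝ, 0 < s → t ≤ α ^ 4 + 1 + R * (s + k * t / s ^ 3) + D * e) → e ≤ √(v * t) →
      e ≤ e' + √(v * q) → q ≤ t - n + 2 * r * √(v * t) →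
      t ≤ α ^ 4 + D * e' + K * α := by
  -- Here `α` plays the role of `a ^ (1/4)`. The bounds are bootstrapped: `t ≤ K₁ α⁴` a priori, then
  -- `t ≤ α⁴ + K₂ α²`, hence `q ≤ K₃ α²`, and so `√(v q)` is only `O(α)`.
  set K₁ := 2 + 2 * (1 + R * (4 * R * k + 1) + D ^ 2 * v) with hK₁
  have hK₁0 : 0 ≤ K₁ := by positivity
  set K₂ := 1 + R * (1 + k * K₁) + D * √(v * K₁) with hK₂
  set K₃ := 1 + K₂ + 2 * r * √(v * K₁) with hK₃
  refine ⟨1 + R * (1 + k * K₁) + D * √(v * K₃), fun α t e e' q n hα ht hq hn h1 h2 h3 h4 => ?_⟩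
  have hα0 : 0 < α := by linarith
  have hα2 : 1 ≤ α ^ 2 := one_le_pow₀ hα
  have hα12 : α ≤ α ^ 2 := le_self_pow₀ hα (by norm_num)
  have hα4 : 1 ≤ α ^ 4 := one_le_pow₀ hα
  have ht1 : t ≤ K₁ * α ^ 4 := by
    have := le_two_mul_add_of_le ht hv hk hD hR h1 h2
    have h0 : 0 ≤ 2 * (1 + R * (4 * R * k + 1) + D ^ 2 * v) := by positivity
    rw [hK₁]
    nlinarith
  have hsq : √(v * t) ≤ √(v * K₁) * α ^ 2 := by
    refine Real.sqrt_le_iff.2 ⟨by positivity, ?_⟩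
    rw [mul_pow, Real.sq_sqrt (by positivity)]
    calc v * t ≤ v * (K₁ * α ^ 4) := by gcongr
      _ = v * K₁ * (α ^ 2) ^ 2 := by ring
  have hov : t ≤ α ^ 4 + (1 + R * (1 + k * K₁)) * α + D * e := by
    -- With `s = α` and `t = O(α⁴)`, both `s` and `k t / s³` are `O(α)`.
    have h5 := h1 α hα0
    have h6 : k * t / α ^ 3 ≤ k * K₁ * α := by
      rw [div_le_iff₀ (by positivity)]
      calc k * t ≤ k * (K₁ * α ^ 4) := by gcongr
        _ = _ := by ring
    have h7 : R * (α + k * t / α ^ 3) ≤ R * (α + k * K₁ * α) := by gcongr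
    linarith
  have ht2 : t ≤ α ^ 4 + K₂ * α ^ 2 := by
    have h5 : D * e ≤ D * (√(v * K₁) * α ^ 2) := by gcongr; exact h2.trans hsq
    have h6 : (1 + R * (1 + k * K₁)) * α ≤ (1 + R * (1 + k * K₁)) * α ^ 2 := by gcongr
    rw [hK₂]
    linarith
  have hq3 : q ≤ K₃ * α ^ 2 := by
    have : 2 * r * √(v * t) ≤ 2 * r * (√(v * K₁) * α ^ 2) := by gcongr
    rw [hK₃]
    linarith
  have hqs : √(v * q) ≤ √(v * K₃) * α := by
    have hK₃0 : 0 ≤ K₃ := by positivity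
    refine Real.sqrt_le_iff.2 ⟨by positivity, ?_⟩
    rw [mul_pow, Real.sq_sqrt (by positivity)]
    calc v * q ≤ v * (K₃ * α ^ 2) := by gcongr
      _ = _ := by ring
  have : D * e ≤ D * (e' + √(v * K₃) * α) := by gcongr; linarith
  linarith

/-- Nonnegativity of the variance of `|f|`. -/
theorem integral_abs_le_sqrt {Ω : Type*} [MeasurableSpace Ω] {μ : Measure Ω}
    [IsProbabilityMeasure μ] {f : Ω → ℝ} (hf : MemLp f 2 μ) :
    ∫ ω, |f ω| ∂μ ≤ √(∫ ω, f ω ^ 2 ∂μ) := by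
  refine Real.le_sqrt_of_sq_le ?_
  have h := variance_nonneg |f| μ
  rw [variance_eq_sub hf.abs] at h
  simp only [Pi.pow_apply, Pi.abs_apply, sq_abs] at h
  linarith

end Inequalities

/-! ### Expected first passage time over the concave boundary. -/

section FirstPassage

variable {Ω : Type*} [mΩ : MeasurableSpace Ω] {X : ℕ → Ω → ℝ} {hX : ∀ i, Measurable (X i)}
  {μ : Measure Ω} {Q : Measure ℝ} {N : Ω → ℕ∞} {w : ℝ → ℝ} {r₀ r₁ a : ℝ}

/-- `N` is the first time `n ≥ 1` at which `n + min (r₀ W_n) (r₁ W_n) ≥ a`, where `W_n` is the sum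
of the `w (X_i)`, `i ≤ n`. -/
structure IsFirstPassage (X : ℕ → Ω → ℝ) (w : ℝ → ℝ) (r₀ r₁ a : ℝ) (N : Ω → ℕ∞) : Prop where
  lt_of_lt : ∀ (n : ℕ) ω, 1 ≤ n → (n : ℕ∞) < N ω →
    n + min (r₀ * ∑ i ∈ Finset.range n, w (X i ω)) (r₁ * ∑ i ∈ Finset.range n, w (X i ω)) < a
  le_of_eq : ∀ (n : ℕ) ω, N ω = n →
    a ≤ n + min (r₀ * ∑ i ∈ Finset.range n, w (X i ω)) (r₁ * ∑ i ∈ Finset.range n, w (X i ω))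

omit mΩ in
-- One step before the truncated time the level `a` has not been exceeded, so only the final step,
-- at most `1 + r₁ |w (X_j)|`, can overshoot it.
theorem IsFirstPassage.truncTime_add_min_le (hNp : IsFirstPassage X w r₀ r₁ a N) (h₀ : 0 ≤ r₀)
    (hr : r₀ ≤ r₁) (ha : 0 ≤ a) (m : ℕ) (ω : Ω) {s : ℝ} (hs : 0 < s) :
    (truncTime N m ω : ℝ) + min (r₀ * ∑ i ∈ Finset.range (truncTime N m ω), w (X i ω))
      (r₁ * ∑ i ∈ Finset.range (truncTime N m ω), w (X i ω)) ≤
    a + 1 + r₁ * (s + (∑ i ∈ Finset.range (truncTime N m ω), w (X i ω) ^ 4) / s ^ 3) := by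
  have hr₁ : 0 ≤ r₁ := h₀.trans hr
  rcases hT : truncTime N m ω with _ | j
  · simp; positivity
  · have hj : (j : ℕ∞) < N ω := (lt_truncTime_iff.1 (hT.symm ▸ Nat.lt_succ_self j :
      j < truncTime N m ω)).1
    have hprev : (j : ℝ) + min (r₀ * ∑ i ∈ Finset.range j, w (X i ω))
        (r₁ * ∑ i ∈ Finset.range j, w (X i ω)) ≤ a := by
      -- Time `0` is never tested by the stopping rule, so `0 ≤ a` is used there instead.
      rcases Nat.eq_zero_or_pos j with rfl | hj1
      · simpa using ha
      · exact (hNp.lt_of_lt j ω hj1 hj).le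
    have hstep := min_mul_add_le h₀ hr (∑ i ∈ Finset.range j, w (X i ω)) (w (X j ω))
    have habs : |w (X j ω)| ≤ s + (∑ i ∈ Finset.range (j + 1), w (X i ω) ^ 4) / s ^ 3 := by
      refine (abs_le_add_pow_four_div _ hs).trans ?_
      gcongr
      exact Finset.single_le_sum (f := fun i => w (X i ω) ^ 4) (fun i _ => by positivity)
        (Finset.self_mem_range_succ j)
    rw [← Finset.sum_range_succ] at hstep
    have := mul_le_mul_of_nonneg_left habs hr₁
    push_cast
    linarith

omit mΩ in
-- Stopping at `T < n ≤ a` is possible only if `r₀ W_T ≥ a - T ≥ n - T`, so the negative part of `T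
-- - n` is at most `r₀ |W_T|`.
theorem IsFirstPassage.abs_truncTime_sub_le (hNp : IsFirstPassage X w r₀ r₁ a N) (h₀ : 0 ≤ r₀)
    {n m : ℕ} (hnm : n ≤ m) (hn : (n : ℝ) ≤ a) (ω : Ω) :
    |(truncTime N m ω : ℝ) - n| ≤ (truncTime N m ω - n) +
      2 * r₀ * |∑ i ∈ Finset.range (truncTime N m ω), w (X i ω)| := by
  set W := ∑ i ∈ Finset.range (truncTime N m ω), w (X i ω) with hW
  rcases le_or_gt n (truncTime N m ω) with h | h
  · rw [abs_of_nonneg (by simpa using h)]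
    have : 0 ≤ 2 * r₀ * |W| := by positivity
    linarith
  · have hlt : N ω < m := by
      by_contra hc
      have : truncTime N m ω = m := by simp [truncTime, min_eq_right (not_lt.1 hc)]
      omega
    have heq : N ω = truncTime N m ω := by
      rw [truncTime, min_eq_left hlt.le, ENat.natCast_toNat hlt.ne_top]
    have h1 := hNp.le_of_eq _ ω heq
    rw [← hW] at h1
    have h2 := min_le_left (r₀ * W) (r₁ * W)
    have h3 : r₀ * W ≤ r₀ * |W| := mul_le_mul_of_nonneg_left (le_abs_self W) h₀
    have h4 : (truncTime N m ω : ℝ) < n := by exact_mod_cast h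
    rw [abs_of_neg (by linarith)]
    linarith

variable (h : IsIID X μ Q) (hN : IsStoppingTime (obsFiltration X hX) N)
  (hNp : IsFirstPassage X w r₀ r₁ a N) (hw : Measurable w) (hw4 : MemLp w 4 Q)
  (hw0 : ∫ x, w x ∂Q = 0)

include h hN hNp hw hw4 hw0

theorem IsFirstPassage.integral_truncTime_le (h₀ : 0 ≤ r₀) (hr : r₀ ≤ r₁) (ha : 0 ≤ a) (m : ℕ)
    {s : ℝ} (hs : 0 < s) :
    ∫ ω, (truncTime N m ω : ℝ) ∂μ ≤ a + 1 +
      r₁ * (s + (∫ x, w x ^ 4 ∂Q) * (∫ ω, (truncTime N m ω : ℝ) ∂μ) / s ^ 3) +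
      (r₁ - r₀) * ∫ ω, max (-∑ i ∈ Finset.range (truncTime N m ω), w (X i ω)) 0 ∂μ := by
  have := h.isProbabilityMeasure
  have hQ := h.isProbabilityMeasure_law hX
  have hwi : Integrable w Q := hw4.integrable (by norm_num)
  have hw4i : Integrable (fun x => w x ^ 4) Q := by
    have := hw4.integrable_norm_pow (by norm_num : (4 : ℕ) ≠ 0)
    simpa [Even.pow_abs (by decide : Even 4)] using this
  obtain ⟨iW, W0⟩ := h.integral_sum_truncTime hN hw hwi m
  obtain ⟨i4, W4⟩ := h.integral_sum_truncTime hN (hw.pow_const 4) hw4i m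
  rw [hw0, mul_zero] at W0
  set W := fun ω => ∑ i ∈ Finset.range (truncTime N m ω), w (X i ω)
  set V := fun ω => ∑ i ∈ Finset.range (truncTime N m ω), w (X i ω) ^ 4
  have iT := integrable_truncTime (μ := μ) hN m
  have iM : Integrable (fun ω => max (-W ω) 0) μ := iW.neg.pos_part
  have i1 : Integrable (fun ω => a + 1 + r₁ * (s + V ω / s ^ 3)) μ :=
    (integrable_const _).add (((integrable_const _).add (i4.div_const _)).const_mul _)
  calc ∫ ω, (truncTime N m ω : ℝ) ∂μ
      -- The linear part `r₀ W` has mean zero by Wald's first identity, so only the negative part of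
      -- `W` survives from the minimum.
      ≤ ∫ ω, ((a + 1 + r₁ * (s + V ω / s ^ 3)) + (r₁ - r₀) * max (-W ω) 0 - r₀ * W ω) ∂μ := by
        refine integral_mono iT ((i1.add (iM.const_mul _)).sub (iW.const_mul _)) fun ω => ?_
        have h1 := hNp.truncTime_add_min_le h₀ hr ha m ω hs
        rw [min_mul_eq hr] at h1
        simp only [V, W]
        linarith
    _ = _ := by
        rw [integral_sub (by exact i1.add (iM.const_mul _)) (iW.const_mul _),
          integral_add i1 (iM.const_mul _), integral_const_mul, integral_const_mul, W0,
          integral_add (integrable_const _)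
            (by exact ((integrable_const _).add (i4.div_const _)).const_mul _), integral_const_mul,
          integral_add (integrable_const _) (i4.div_const _), integral_div, W4]
        simp only [integral_const, probReal_univ, smul_eq_mul]
        ring

omit hNp in
theorem IsIID.integral_abs_sum_truncTime_le (m : ℕ) :
    ∫ ω, |∑ i ∈ Finset.range (truncTime N m ω), w (X i ω)| ∂μ ≤
      √((∫ x, w x ^ 2 ∂Q) * ∫ ω, (truncTime N m ω : ℝ) ∂μ) := by
  have := h.isProbabilityMeasure
  have hQ := h.isProbabilityMeasure_law hX
  obtain ⟨hL, hE⟩ := h.integral_sq_sum_truncTime hN hw (hw4.mono_exponent (by norm_num)) hw0 m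
  rw [mul_comm, ← hE]
  exact integral_abs_le_sqrt hL

omit hNp in
theorem IsIID.integral_negPart_sum_truncTime_le (m : ℕ) :
    ∫ ω, max (-∑ i ∈ Finset.range (truncTime N m ω), w (X i ω)) 0 ∂μ ≤
      √((∫ x, w x ^ 2 ∂Q) * ∫ ω, (truncTime N m ω : ℝ) ∂μ) := by
  have := h.isProbabilityMeasure
  have hQ := h.isProbabilityMeasure_law hX
  have iW := (h.integral_sum_truncTime hN hw (hw4.integrable (by norm_num)) m).1
  refine (integral_mono iW.neg.pos_part iW.abs fun ω => ?_).trans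
    (h.integral_abs_sum_truncTime_le hN hw hw4 hw0 m)
  exact max_le (neg_le_abs _) (abs_nonneg _)

omit hNp in
-- The negative part is `1`-Lipschitz, and the mean distance between the two sums is bounded by
-- their `L²` distance, which Wald's second identity computes.
theorem IsIID.integral_negPart_sum_truncTime_le_add {n m : ℕ} (hnm : n ≤ m) :
    ∫ ω, max (-∑ i ∈ Finset.range (truncTime N m ω), w (X i ω)) 0 ∂μ ≤
      ∫ ω, max (-∑ i ∈ Finset.range n, w (X i ω)) 0 ∂μ +
      √((∫ x, w x ^ 2 ∂Q) * ∫ ω, |(truncTime N m ω : ℝ) - n| ∂μ) := by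
  have := h.isProbabilityMeasure
  have hQ := h.isProbabilityMeasure_law hX
  have hw2 : MemLp w 2 Q := hw4.mono_exponent (by norm_num)
  have hwi : Integrable w Q := hw4.integrable (by norm_num)
  have L1 := (h.integral_sq_sum_truncTime hN hw hw2 hw0 m).1
  have L2 := (h.integral_sq_sum_truncTime (isStoppingTime_natCast X hX n) hw hw2 hw0 m).1
  simp only [truncTime_natCast hnm] at L2
  have L3 := L1.sub L2
  have i1 := L1.integrable (by norm_num)
  have i2 := L2.integrable (by norm_num)
  have i3 := i1.sub i2
  rw [mul_comm, ← h.integral_sq_sum_truncTime_sub hN hw hw2 hw0 hnm]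
  refine le_trans ?_ (add_le_add_right (integral_abs_le_sqrt L3) _)
  have j2 : Integrable (fun ω => max (-∑ i ∈ Finset.range n, w (X i ω)) 0) μ := i2.neg.pos_part
  rw [← integral_add j2 (by exact i3.abs)]
  refine integral_mono i1.neg.pos_part (j2.add i3.abs) fun ω => ?_
  simp only [Pi.sub_apply]
  set x := ∑ i ∈ Finset.range (truncTime N m ω), w (X i ω)
  set y := ∑ i ∈ Finset.range n, w (X i ω)
  refine max_le ?_ (by positivity)
  have h1 := neg_abs_le (x - y)
  have h2 := le_max_left (-y) 0
  linarith

theorem IsFirstPassage.integral_abs_truncTime_sub_le (h₀ : 0 ≤ r₀) {n m : ℕ} (hnm : n ≤ m)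
    (hn : (n : ℝ) ≤ a) :
    ∫ ω, |(truncTime N m ω : ℝ) - n| ∂μ ≤ ∫ ω, (truncTime N m ω : ℝ) ∂μ - n +
      2 * r₀ * √((∫ x, w x ^ 2 ∂Q) * ∫ ω, (truncTime N m ω : ℝ) ∂μ) := by
  have := h.isProbabilityMeasure
  have hQ := h.isProbabilityMeasure_law hX
  have iW := (h.integral_sum_truncTime hN hw (hw4.integrable (by norm_num)) m).1
  have iT := integrable_truncTime (μ := μ) hN m
  have iTn : Integrable (fun ω => (truncTime N m ω : ℝ) - n) μ := iT.sub (integrable_const _)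
  refine (integral_mono iTn.abs (iTn.add (iW.abs.const_mul (2 * r₀)))
    fun ω => hNp.abs_truncTime_sub_le h₀ hnm hn ω).trans ?_
  simp only [Pi.add_apply]
  rw [integral_add iTn (iW.abs.const_mul _), integral_sub iT (integrable_const _),
    integral_const_mul, integral_const, probReal_univ, one_smul]
  gcongr
  exact h.integral_abs_sum_truncTime_le hN hw hw4 hw0 m

theorem IsFirstPassage.expect_ne_top (h₀ : 0 ≤ r₀) (hr : r₀ ≤ r₁) (ha : 0 ≤ a) :
    expect μ N ≠ ⊤ := by
  have := h.isProbabilityMeasure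
  refine ne_top_of_le_ne_top ENNReal.ofReal_ne_top
    (expect_le_of_forall_integral_truncTime_le hN (B := 2 * a + 2 * (1 + r₁ * (4 * r₁ *
      (∫ x, w x ^ 4 ∂Q) + 1) + (r₁ - r₀) ^ 2 * ∫ x, w x ^ 2 ∂Q)) 0 fun m _ => ?_)
  exact le_two_mul_add_of_le (integral_nonneg fun ω => Nat.cast_nonneg _)
    (integral_nonneg fun x => sq_nonneg (w x)) (integral_nonneg fun x => by positivity)
    (sub_nonneg.2 hr) (h₀.trans hr)
    (fun s hs => hNp.integral_truncTime_le h hN hw hw4 hw0 h₀ hr ha m hs)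
    (h.integral_negPart_sum_truncTime_le hN hw hw4 hw0 m)

omit hN hNp in
/-- The expected first passage time is, up to `O(a ^ (1 / 4))`, at most
`a + (r₁ - r₀) E (W_n)⁻` with `n = ⌊a⌋`. -/
theorem IsIID.exists_expect_firstPassage_le (hX : ∀ i, Measurable (X i)) (h₀ : 0 ≤ r₀)
    (hr : r₀ ≤ r₁) :
    ∃ K : ℝ, ∀ (a : ℝ) (N : Ω → ℕ∞), 1 ≤ a → IsStoppingTime (obsFiltration X hX) N →
      IsFirstPassage X w r₀ r₁ a N →
      (expect μ N).toReal ≤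
        a + (r₁ - r₀) * ∫ ω, max (-∑ i ∈ Finset.range ⌊a⌋₊, w (X i ω)) 0 ∂μ + K * √√a := by
  have := h.isProbabilityMeasure
  obtain ⟨K, hK⟩ := exists_le_add_mul_of_le (v := ∫ x, w x ^ 2 ∂Q) (k := ∫ x, w x ^ 4 ∂Q)
    (integral_nonneg fun x => sq_nonneg (w x)) (integral_nonneg fun x => by positivity)
    (sub_nonneg.2 hr) (h₀.trans hr) h₀
  refine ⟨K, fun a N ha hN hNp => ?_⟩
  have ha0 : 0 ≤ a := by linarith
  -- The numerical bootstrap is run with `α = √√a` and `n = ⌊a⌋`.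
  have hα4 : √√a ^ 4 = a := by
    rw [show 4 = 2 * 2 from rfl, pow_mul, Real.sq_sqrt (Real.sqrt_nonneg a), Real.sq_sqrt ha0]
  have hα1 : 1 ≤ √√a := Real.one_le_sqrt.2 (Real.one_le_sqrt.2 ha)
  have hbound : ∀ m, ⌊a⌋₊ ≤ m → ∫ ω, (truncTime N m ω : ℝ) ∂μ ≤
      a + (r₁ - r₀) * ∫ ω, max (-∑ i ∈ Finset.range ⌊a⌋₊, w (X i ω)) 0 ∂μ + K * √√a := by
    intro m hm
    have := hK (√√a) (∫ ω, (truncTime N m ω : ℝ) ∂μ) _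
      (∫ ω, max (-∑ i ∈ Finset.range ⌊a⌋₊, w (X i ω)) 0 ∂μ)
      (∫ ω, |(truncTime N m ω : ℝ) - ⌊a⌋₊| ∂μ) ⌊a⌋₊ hα1
      (integral_nonneg fun ω => Nat.cast_nonneg _) (integral_nonneg fun ω => abs_nonneg _)
      (by rw [hα4]; exact (Nat.lt_floor_add_one a).le)
      (fun s hs => by
        rw [hα4]; exact hNp.integral_truncTime_le h hN hw hw4 hw0 h₀ hr ha0 m hs)
      (h.integral_negPart_sum_truncTime_le hN hw hw4 hw0 m)
      (h.integral_negPart_sum_truncTime_le_add hN hw hw4 hw0 hm)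
      (hNp.integral_abs_truncTime_sub_le h hN hw hw4 hw0 h₀ hm (Nat.floor_le ha0))
    rwa [hα4] at this
  refine ENNReal.toReal_le_of_le_ofReal ?_
    (expect_le_of_forall_integral_truncTime_le hN ⌊a⌋₊ hbound)
  exact (integral_nonneg fun ω => Nat.cast_nonneg _).trans (hbound _ le_rfl)

end FirstPassage

/-! ### Mean negative part of a centred random walk via the central limit theorem. -/

section NegativePart

theorem integral_negPart_gaussianReal {v : NNReal} (hv : v ≠ 0) :
    ∫ x, max (-x) 0 ∂(gaussianReal 0 v) = √(v / (2 * Real.pi)) := by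
  have hv0 : (0 : ℝ) < v := by positivity
  rw [integral_gaussianReal_eq_integral_smul hv, ← integral_neg_eq_self]
  simp only [gaussianPDFReal, neg_neg, smul_eq_mul, sub_zero, neg_sq]
  have e : (fun x : ℝ => (√(2 * Real.pi * v))⁻¹ * Real.exp (-x ^ 2 / (2 * v)) * max x 0) =
      (Set.Ioi 0).indicator fun x : ℝ =>
        (√(2 * Real.pi * v))⁻¹ * (x ^ (1 : ℝ) * Real.exp (-(2 * (v : ℝ))⁻¹ * x ^ (2 : ℝ))) := by
    ext x
    by_cases hx : 0 < x
    · rw [Set.indicator_of_mem (by exact hx), max_eq_left hx.le, Real.rpow_one, Real.rpow_two,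
        mul_assoc, mul_comm x]
      congr 3
      field_simp
    · rw [Set.indicator_of_notMem (by exact hx), max_eq_right (not_lt.1 hx), mul_zero]
  rw [e, integral_indicator measurableSet_Ioi, integral_const_mul,
    integral_rpow_mul_exp_neg_mul_rpow (by norm_num) (by norm_num) (by positivity)]
  norm_num
  rw [Real.rpow_neg_one]
  have := Real.sq_sqrt hv0.le
  field_simp
  linarith

variable {Ω : Type*} [mΩ : MeasurableSpace Ω] {X : ℕ → Ω → ℝ} {μ : Measure Ω} {Q : Measure ℝ}
  {w : ℝ → ℝ}

/-- By the central limit theorem, the mean negative part of a centred random walk is asymptotically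
at most `√(v n / (2 π))`. -/
theorem IsIID.eventually_integral_negPart_le (h : IsIID X μ Q) (hX : ∀ i, Measurable (X i))
    (hw : Measurable w) (hw2 : MemLp w 2 Q) (hw0 : ∫ x, w x ∂Q = 0)
    (hv : 0 < ∫ x, w x ^ 2 ∂Q) {ε : ℝ} (hε : 0 < ε) :
    ∀ᶠ n : ℕ in atTop, ∫ ω, max (-∑ i ∈ Finset.range n, w (X i ω)) 0 ∂μ ≤
      (√((∫ x, w x ^ 2 ∂Q) / (2 * Real.pi)) + ε) * √n := by
  have := h.isProbabilityMeasure
  have hQ := h.isProbabilityMeasure_law hX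
  have hwi : Integrable w Q := hw2.integrable (by norm_num)
  set v := ∫ x, w x ^ 2 ∂Q with hvdef
  set U : ℕ → Ω → ℝ := fun i ω => w (X i ω) with hU
  have hUm : ∀ i, Measurable (U i) := fun i => hw.comp (hX i)
  have hU2 : MemLp (U 0) 2 μ := by
    rw [← h.map_eq 0] at hw2
    exact hw2.comp_measurePreserving ⟨hX 0, rfl⟩
  have hU0 : ∫ ω, U 0 ω ∂μ = 0 := by rw [← hw0]; exact h.integral_comp hX hwi 0
  have hUv : Var[U 0; μ] = v := by
    rw [variance_of_integral_eq_zero (hUm 0).aemeasurable hU0]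
    exact h.integral_comp hX hw2.integrable_sq 0
  have hUind : iIndepFun U μ := h.indep.comp (fun _ => w) fun _ => hw
  have hUid : ∀ i, IdentDistrib (U i) (U 0) μ μ := fun i =>
    (IdentDistrib.mk (hX i).aemeasurable (hX 0).aemeasurable
      ((h.map_eq i).trans (h.map_eq 0).symm)).comp hw
  have clt := tendstoInDistribution_inv_sqrt_mul_sum_sub (Y := id)
    (P' := gaussianReal 0 Var[U 0; μ].toNNReal) HasLaw.id hU2 hUind hUid
  simp only [hU0, mul_zero, sub_zero, hUv] at clt
  -- Weak convergence only handles bounded test functions, so the negative part is capped at `K`.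
  -- The excess is at most `Z² / K`, with mean `v / K ≤ ε / 2`.
  set K := 2 * (v + 1) / ε with hK
  have hK0 : 0 < K := by positivity
  let f : BoundedContinuousFunction ℝ ℝ := BoundedContinuousFunction.ofNormedAddCommGroup
    (fun x => min (max (-x) 0) K) (by fun_prop) K fun x => by
      rw [Real.norm_of_nonneg (le_min (le_max_right _ _) hK0.le)]
      exact min_le_right _ _
  have hlim := (ProbabilityMeasure.tendsto_iff_forall_integral_tendsto.1 clt.tendsto) f
  have hgauss : ∫ x, f x ∂(gaussianReal 0 v.toNNReal) ≤ √(v / (2 * Real.pi)) := by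
    have hvne : v.toNNReal ≠ 0 := by simpa using hv
    have := integral_negPart_gaussianReal hvne
    rw [Real.coe_toNNReal _ hv.le] at this
    rw [← this]
    have hid : Integrable (fun x : ℝ => x) (gaussianReal 0 v.toNNReal) :=
      (memLp_id_gaussianReal 1).integrable le_rfl
    exact integral_mono (f.integrable _) hid.neg.pos_part fun x => min_le_left _ _
  simp only [ProbabilityMeasure.coe_mk, Measure.map_id] at hlim
  have hev := hlim.eventually (gt_mem_nhds (lt_of_le_of_lt hgauss
    (lt_add_of_pos_right _ (half_pos hε))))
  filter_upwards [hev, eventually_gt_atTop 0] with n hn hn0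
  have hsn : 0 < √(n : ℝ) := Real.sqrt_pos.2 (by exact_mod_cast hn0)
  have hWm : Measurable fun ω => ∑ i ∈ Finset.range n, U i ω :=
    Finset.measurable_fun_sum _ fun i _ => hUm i
  set Z : Ω → ℝ := fun ω => (√n)⁻¹ * ∑ i ∈ Finset.range n, U i ω with hZ
  have hZm : Measurable Z := hWm.const_mul _
  rw [integral_map hZm.aemeasurable f.continuous.aestronglyMeasurable] at hn
  have hWald := h.integral_sq_sum_truncTime (isStoppingTime_natCast X hX n) hw hw2 hw0 n
  simp only [truncTime_natCast le_rfl, integral_const, probReal_univ, one_smul] at hWald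
  obtain ⟨hWL, hWsq⟩ := hWald
  have hZL : MemLp Z 2 μ := hWL.const_mul _
  have hZsq : ∫ ω, Z ω ^ 2 ∂μ = v := by
    simp only [hZ, mul_pow]
    rw [integral_const_mul]
    simp only [hU]
    rw [hWsq, inv_pow, Real.sq_sqrt (Nat.cast_nonneg n), inv_mul_cancel_left₀]
    positivity
  have hbound : ∫ ω, max (-Z ω) 0 ∂μ ≤ √(v / (2 * Real.pi)) + ε := by
    have i1 : Integrable (fun ω => f (Z ω)) μ :=
      Integrable.of_bound (f.continuous.measurable.comp hZm).aestronglyMeasurable ‖f‖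
        (ae_of_all _ fun ω => f.norm_coe_le_norm _)
    have i2 : Integrable (fun ω => Z ω ^ 2 / K) μ := hZL.integrable_sq.div_const _
    calc ∫ ω, max (-Z ω) 0 ∂μ ≤ ∫ ω, (f (Z ω) + Z ω ^ 2 / K) ∂μ := by
          refine integral_mono (hZL.integrable (by norm_num)).neg.pos_part (i1.add i2) fun ω => ?_
          change max (-Z ω) 0 ≤ min (max (-Z ω) 0) K + Z ω ^ 2 / K
          rcases le_total (max (-Z ω) 0) K with hc | hc
          · rw [min_eq_left hc]
            have : 0 ≤ Z ω ^ 2 / K := by positivity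
            linarith
          · have h1 : max (-Z ω) 0 ≤ Z ω ^ 2 / K := by
              rw [le_div_iff₀ hK0]
              have h2 : max (-Z ω) 0 = -Z ω := by
                rcases max_choice (-Z ω) 0 with h3 | h3
                · exact h3
                · rw [h3] at hc; linarith
              rw [h2] at hc ⊢
              nlinarith
            rw [min_eq_right hc]
            linarith
      _ = ∫ ω, f (Z ω) ∂μ + v / K := by rw [integral_add i1 i2, integral_div, hZsq]
      _ ≤ √(v / (2 * Real.pi)) + ε := by
          have : v / K ≤ ε / 2 := by
            rw [hK, div_div_eq_mul_div, div_le_div_iff₀ (by positivity) (by norm_num)]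
            nlinarith
          linarith
  have e : ∀ ω, max (-∑ i ∈ Finset.range n, w (X i ω)) 0 = max (-Z ω) 0 * √n := fun ω => by
    rw [max_mul_of_nonneg _ _ hsn.le, zero_mul]
    congr 1
    simp only [hZ, hU]
    field_simp
  simp_rw [e]
  rw [integral_mul_const]
  gcongr

end NegativePart

/-! ### First times as infima in `ℕ∞`. -/

section FirstTime

variable {p : ℕ → Prop}

theorem not_of_lt_iInf_natCast {n : ℕ} (h : (n : ℕ∞) < ⨅ (k : ℕ) (_ : p k), (k : ℕ∞)) : ¬ p n :=
  fun hp => absurd (iInf₂_le n hp) (not_le.2 h)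

theorem iInf_natCast_le_iff {n : ℕ} :
    ⨅ (k : ℕ) (_ : p k), (k : ℕ∞) ≤ n ↔ ∃ k ≤ n, p k := by
  constructor
  · intro h
    by_contra! hc
    have h1 : ((n + 1 : ℕ) : ℕ∞) ≤ ⨅ (k : ℕ) (_ : p k), (k : ℕ∞) := by
      refine le_iInf₂ fun k hk => ?_
      have : n < k := not_le.1 fun hkn => hc k hkn hk
      exact_mod_cast this
    have h2 := h1.trans h
    have : n + 1 ≤ n := by exact_mod_cast h2
    omega
  · rintro ⟨k, hk, hp⟩
    exact (iInf₂_le k hp).trans (by exact_mod_cast hk)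

theorem of_iInf_natCast_eq {n : ℕ} (h : ⨅ (k : ℕ) (_ : p k), (k : ℕ∞) = n) : p n := by
  obtain ⟨k, hk, hp⟩ := iInf_natCast_le_iff.1 h.le
  have h1 : (n : ℕ∞) ≤ k := h ▸ iInf₂_le k hp
  have h2 : n ≤ k := by exact_mod_cast h1
  rwa [le_antisymm h2 hk]

end FirstTime

/-! ### The stopping time `M(a)` as a first passage time. -/

section StopM

variable {Ω : Type*} {F : Measure ℝ} {X : ℕ → Ω → ℝ} {θ₀ θ₁ lam θ a : ℝ}

theorem measurable_logLR (F : Measure ℝ) (lam θ : ℝ) : Measurable (logLR F lam θ) := by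
  unfold logLR density
  fun_prop

/-- Puts the law at `θ` in the form required by the change-of-measure lemmas. -/
theorem withDensity_exp_neg_logLR (F : Measure ℝ) (lam θ : ℝ) :
    (law F lam).withDensity (fun x => ENNReal.ofReal (Real.exp (-logLR F lam θ x))) =
      law F θ := by
  unfold law
  rw [← withDensity_mul]
  · congr 1
    ext x
    rw [Pi.mul_apply, density, density, ← ENNReal.ofReal_mul (Real.exp_pos _).le, logLR_eq,
      ← Real.exp_add]
    congr 2
    ring
  · unfold density; fun_prop
  · exact (measurable_logLR F lam θ).neg.exp.ennreal_ofReal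

theorem mem_naturalParam_of_mem_Icc (hθ₀ : θ₀ ∈ naturalParam F) (hlam : lam ∈ naturalParam F)
    (h1 : θ₁ < lam) (hθ : θ ∈ Set.Icc θ₀ θ₁) : θ ∈ naturalParam F :=
  (convex_naturalParam F).ordConnected.out hθ₀ hlam ⟨hθ.1, hθ.2.trans h1.le⟩

theorem sum_logLR_eq (hF : ∀ c : ℝ, ¬ ∀ᵐ x ∂F, x = c) (hlam : lam ∈ naturalParam F)
    (θ : ℝ) (X : ℕ → Ω → ℝ) (n : ℕ) (ω : Ω) :
    ∑ i ∈ Finset.range n, logLR F lam θ (X i ω) =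
      n * klInfo F lam θ +
        (lam - θ) * ∑ i ∈ Finset.range n, (X i ω - deriv (logNorm F) lam) := by
  simp_rw [logLR_eq_klInfo_add hF hlam, Finset.sum_add_distrib, Finset.mul_sum]
  simp

theorem klInfo_mul_le_sum_logLR_iff (hF : ∀ c : ℝ, ¬ ∀ᵐ x ∂F, x = c)
    (hlam : lam ∈ naturalParam F) (hθ : θ ∈ naturalParam F) (h : θ < lam) (n : ℕ) (ω : Ω) :
    klInfo F lam θ * a ≤ ∑ i ∈ Finset.range n, logLR F lam θ (X i ω) ↔
      a ≤ n + (lam - θ) / klInfo F lam θ *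
        ∑ i ∈ Finset.range n, (X i ω - deriv (logNorm F) lam) := by
  have hI := klInfo_pos hF hlam hθ h
  rw [sum_logLR_eq hF hlam, ← mul_le_mul_iff_right₀ hI (b := a)]
  have : klInfo F lam θ * (n + (lam - θ) / klInfo F lam θ *
      ∑ i ∈ Finset.range n, (X i ω - deriv (logNorm F) lam)) = n * klInfo F lam θ +
      (lam - θ) * ∑ i ∈ Finset.range n, (X i ω - deriv (logNorm F) lam) := by
    field_simp
  rw [this]

/-- The stopping region of `stopM` is determined by the two end points `θ₀` and `θ₁`. -/
theorem forall_klInfo_mul_le_iff (hF : ∀ c : ℝ, ¬ ∀ᵐ x ∂F, x = c) (hθ₀ : θ₀ ∈ naturalParam F)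
    (h01 : θ₀ < θ₁) (h1 : θ₁ < lam) (hlam : lam ∈ naturalParam F) (n : ℕ) (ω : Ω) :
    (∀ θ ∈ Set.Icc θ₀ θ₁,
      klInfo F lam θ * a ≤ ∑ i ∈ Finset.range n, logLR F lam θ (X i ω)) ↔
    a ≤ n + min ((lam - θ₀) / klInfo F lam θ₀ *
        ∑ i ∈ Finset.range n, (X i ω - deriv (logNorm F) lam))
      ((lam - θ₁) / klInfo F lam θ₁ *
        ∑ i ∈ Finset.range n, (X i ω - deriv (logNorm F) lam)) := by
  have hmem := fun θ hθ => mem_naturalParam_of_mem_Icc (θ := θ) hθ₀ hlam h1 hθ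
  have m0 : θ₀ ∈ Set.Icc θ₀ θ₁ := Set.left_mem_Icc.2 h01.le
  have m1 : θ₁ ∈ Set.Icc θ₀ θ₁ := Set.right_mem_Icc.2 h01.le
  set W := ∑ i ∈ Finset.range n, (X i ω - deriv (logNorm F) lam) with hW
  constructor
  · intro h
    have e0 := (klInfo_mul_le_sum_logLR_iff hF hlam hθ₀ (h01.trans h1) n ω).1 (h θ₀ m0)
    have e1 := (klInfo_mul_le_sum_logLR_iff hF hlam (hmem _ m1) h1 n ω).1 (h θ₁ m1)
    rw [← min_add_add_left]
    exact le_min e0 e1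
  · intro h θ hθ
    rw [klInfo_mul_le_sum_logLR_iff hF hlam (hmem _ hθ) (hθ.2.trans_lt h1), ← hW]
    refine h.trans (add_le_add_right ?_ _)
    -- Since the ratio `(λ - θ) / I(λ, θ)` increases with `θ`, the binding constraint is `θ₀` when
    -- `W ≥ 0` and `θ₁` when `W ≤ 0`.
    rcases le_total 0 W with hW0 | hW0
    · exact (min_le_left _ _).trans (mul_le_mul_of_nonneg_right
        (div_klInfo_le hF hlam hθ₀ (hmem _ hθ) hθ.1 (hθ.2.trans_lt h1)) hW0)
    · exact (min_le_right _ _).trans (mul_le_mul_of_nonpos_right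
        (div_klInfo_le hF hlam (hmem _ hθ) (hmem _ m1) hθ.2 h1) hW0)

theorem isFirstPassage_stopM (hF : ∀ c : ℝ, ¬ ∀ᵐ x ∂F, x = c) (hθ₀ : θ₀ ∈ naturalParam F)
    (h01 : θ₀ < θ₁) (h1 : θ₁ < lam) (hlam : lam ∈ naturalParam F) (X : ℕ → Ω → ℝ) (a : ℝ) :
    IsFirstPassage X (fun x => x - deriv (logNorm F) lam) ((lam - θ₀) / klInfo F lam θ₀)
      ((lam - θ₁) / klInfo F lam θ₁) a (stopM F X θ₀ θ₁ lam a) where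
  lt_of_lt n ω hn hlt := by
    have h := not_of_lt_iInf_natCast hlt
    rw [forall_klInfo_mul_le_iff hF hθ₀ h01 h1 hlam] at h
    exact not_le.1 fun hc => h ⟨hn, hc⟩
  le_of_eq n ω heq := by
    have h := (of_iInf_natCast_eq heq).2
    rwa [forall_klInfo_mul_le_iff hF hθ₀ h01 h1 hlam] at h

theorem klInfo_mul_le_of_stopM_eq {n : ℕ} {ω : Ω} (h : stopM F X θ₀ θ₁ lam a ω = n)
    (hθ : θ ∈ Set.Icc θ₀ θ₁) :
    klInfo F lam θ * a ≤ ∑ i ∈ Finset.range n, logLR F lam θ (X i ω) :=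
  (of_iInf_natCast_eq h).2 θ hθ

theorem isStoppingTime_stopM [MeasurableSpace Ω] (hF : ∀ c : ℝ, ¬ ∀ᵐ x ∂F, x = c)
    (hθ₀ : θ₀ ∈ naturalParam F) (h01 : θ₀ < θ₁) (h1 : θ₁ < lam) (hlam : lam ∈ naturalParam F)
    (hX : ∀ i, Measurable (X i)) (a : ℝ) :
    IsStoppingTime (obsFiltration X hX) (stopM F X θ₀ θ₁ lam a) := by
  intro n
  -- Reduction to the end points replaces an uncountable intersection over `θ` by a single
  -- measurable condition.
  have e : {ω | stopM F X θ₀ θ₁ lam a ω ≤ n} = ⋃ (k : ℕ) (_ : k ≤ n) (_ : 1 ≤ k),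
      {ω | a ≤ k + min ((lam - θ₀) / klInfo F lam θ₀ *
        ∑ i ∈ Finset.range k, (X i ω - deriv (logNorm F) lam))
      ((lam - θ₁) / klInfo F lam θ₁ *
        ∑ i ∈ Finset.range k, (X i ω - deriv (logNorm F) lam))} := by
    ext ω
    simp only [Set.mem_ofPred_eq, Set.mem_iUnion, exists_prop]
    refine iInf_natCast_le_iff.trans (exists_congr fun k => and_congr_right fun _ =>
      and_congr_right fun _ => ?_)
    exact forall_klInfo_mul_le_iff hF hθ₀ h01 h1 hlam k ω
  change MeasurableSet[obsFiltration X hX n] {ω | stopM F X θ₀ θ₁ lam a ω ≤ n}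
  rw [e]
  refine MeasurableSet.iUnion fun k => MeasurableSet.iUnion fun hk => MeasurableSet.iUnion
    fun _ => ?_
  have hS : Measurable[obsFiltration X hX n]
      (fun ω => ∑ i ∈ Finset.range k, (X i ω - deriv (logNorm F) lam)) :=
    Finset.measurable_fun_sum (m := obsFiltration X hX n) _ fun i hi =>
      (measurable_obsFiltration X hX ((Finset.mem_range.1 hi).trans_le hk)).sub_const _
  exact measurableSet_le measurable_const
    (measurable_const.add ((hS.const_mul _).min (hS.const_mul _)))

theorem constC_pos (hF : ∀ c : ℝ, ¬ ∀ᵐ x ∂F, x = c) (hθ₀ : θ₀ ∈ naturalParam F)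
    (h01 : θ₀ < θ₁) (h1 : θ₁ < lam) (hlam : lam ∈ naturalParam F) :
    0 < constC F θ₀ θ₁ lam := by
  have hθ₁ := mem_naturalParam_of_mem_Icc hθ₀ hlam h1 (Set.right_mem_Icc.2 h01.le)
  have hv := iteratedDeriv_two_logNorm_pos hF hlam
  exact mul_pos (sub_pos.2 (div_klInfo_lt hF hlam hθ₀ hθ₁ h01 h1))
    (Real.sqrt_pos.2 (by positivity))

end StopM

/-! ### Asymptotic sample size and error probabilities. -/

section Asymptotics

variable {Ω : Type*} [MeasurableSpace Ω] {F : Measure ℝ} {X : ℕ → Ω → ℝ} {μ ν : Measure Ω}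
  {θ₀ θ₁ lam θ a : ℝ}

theorem memLp_sub_deriv_logNorm (hF : ∀ c : ℝ, ¬ ∀ᵐ x ∂F, x = c) (hlam : lam ∈ naturalParam F)
    (p : NNReal) : MemLp (fun x => x - deriv (logNorm F) lam) p (law F lam) := by
  have := isProbabilityMeasure_law hF hlam
  exact (memLp_law hF hlam p).sub (memLp_const _)

theorem integral_sub_deriv_logNorm (hF : ∀ c : ℝ, ¬ ∀ᵐ x ∂F, x = c)
    (hlam : lam ∈ naturalParam F) : ∫ x, (x - deriv (logNorm F) lam) ∂(law F lam) = 0 := by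
  have := isProbabilityMeasure_law hF hlam
  rw [integral_sub ((memLp_law hF hlam 1).integrable le_rfl) (integrable_const _),
    integral_law hF hlam]
  simp

theorem expect_stopM_ne_top (hF : ∀ c : ℝ, ¬ ∀ᵐ x ∂F, x = c) (hX : ∀ i, Measurable (X i))
    (h : IsIID X μ (law F lam)) (hθ₀ : θ₀ ∈ naturalParam F) (h01 : θ₀ < θ₁) (h1 : θ₁ < lam)
    (hlam : lam ∈ naturalParam F) (ha : 0 < a) : expect μ (stopM F X θ₀ θ₁ lam a) ≠ ⊤ := by
  have hθ₁ := mem_naturalParam_of_mem_Icc hθ₀ hlam h1 (Set.right_mem_Icc.2 h01.le)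
  exact (isFirstPassage_stopM hF hθ₀ h01 h1 hlam X a).expect_ne_top h
    (isStoppingTime_stopM hF hθ₀ h01 h1 hlam hX a) (by fun_prop)
    (by exact_mod_cast memLp_sub_deriv_logNorm hF hlam 4) (integral_sub_deriv_logNorm hF hlam)
    (div_klInfo_pos hF hlam hθ₀ (h01.trans h1)).le
    (div_klInfo_lt hF hlam hθ₀ hθ₁ h01 h1).le ha.le

/-- `E M(a) ≤ a + (C + o(1)) √a`. -/
theorem eventually_expect_stopM_le (hF : ∀ c : ℝ, ¬ ∀ᵐ x ∂F, x = c) (hX : ∀ i, Measurable (X i))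
    (h : IsIID X μ (law F lam)) (hθ₀ : θ₀ ∈ naturalParam F) (h01 : θ₀ < θ₁) (h1 : θ₁ < lam)
    (hlam : lam ∈ naturalParam F) {ε : ℝ} (hε : 0 < ε) :
    ∀ᶠ a : ℝ in atTop, (expect μ (stopM F X θ₀ θ₁ lam a)).toReal ≤
      a + (constC F θ₀ θ₁ lam + ε) * √a := by
  have hθ₁ := mem_naturalParam_of_mem_Icc hθ₀ hlam h1 (Set.right_mem_Icc.2 h01.le)
  have hr := div_klInfo_lt hF hlam hθ₀ hθ₁ h01 h1
  have hw0 := integral_sub_deriv_logNorm hF hlam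
  obtain ⟨K, hK⟩ := h.exists_expect_firstPassage_le (by fun_prop)
    (by exact_mod_cast memLp_sub_deriv_logNorm hF hlam 4) hw0 hX
    (div_klInfo_pos hF hlam hθ₀ (h01.trans h1)).le hr.le
  rw [← sub_pos] at hr
  set D := (lam - θ₁) / klInfo F lam θ₁ - (lam - θ₀) / klInfo F lam θ₀ with hD
  have hv := variance_law hF hlam
  have hclt := h.eventually_integral_negPart_le hX (by fun_prop)
    (by exact_mod_cast memLp_sub_deriv_logNorm hF hlam 2) hw0
    -- The tolerance is split: `ε / (2 D)` in the central limit theorem becomes `ε / 2` after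
    -- multiplication by `D`, and the other `ε / 2` absorbs the `O(a ^ (1/4))` remainder.
    (hv ▸ iteratedDeriv_two_logNorm_pos hF hlam) (ε := ε / (2 * D)) (by positivity)
  rw [hv] at hclt
  have hs : ∀ᶠ a : ℝ in atTop, 2 * |K| / ε ≤ √√a :=
    (Real.tendsto_sqrt_atTop.comp Real.tendsto_sqrt_atTop).eventually_ge_atTop _
  filter_upwards [(tendsto_nat_floor_atTop (α := ℝ)).eventually hclt, hs, eventually_ge_atTop 1]
    with a ha has ha1
  have hbound := hK a _ ha1 (isStoppingTime_stopM hF hθ₀ h01 h1 hlam hX a)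
    (isFirstPassage_stopM hF hθ₀ h01 h1 hlam X a)
  have hfl : √(⌊a⌋₊ : ℝ) ≤ √a := Real.sqrt_le_sqrt (Nat.floor_le (by linarith))
  have hsq : √√a * √√a = √a := Real.mul_self_sqrt (Real.sqrt_nonneg a)
  have h3 : K * √√a ≤ ε / 2 * √a := by
    rw [div_le_iff₀ hε] at has
    have h4 : K * √√a ≤ |K| * √√a := by gcongr; exact le_abs_self K
    have h5 : |K| * √√a ≤ (ε / 2 * √√a) * √√a := by gcongr; linarith
    have h6 : ε / 2 * √√a * √√a = ε / 2 * √a := by rw [mul_assoc, hsq]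
    linarith
  set s := √(iteratedDeriv 2 (logNorm F) lam / (2 * Real.pi)) with hsdef
  have h6 : D * ∫ ω, max (-∑ i ∈ Finset.range ⌊a⌋₊, (X i ω - deriv (logNorm F) lam)) 0 ∂μ ≤
      D * ((s + ε / (2 * D)) * √a) := by
    refine mul_le_mul_of_nonneg_left (ha.trans ?_) hr.le
    gcongr
  have h7 : D * ((s + ε / (2 * D)) * √a) = (D * s + ε / 2) * √a := by
    field_simp
  have h8 : constC F θ₀ θ₁ lam = D * s := rfl
  rw [h8]
  linarith

theorem neg_log_errProb_le (hF : ∀ c : ℝ, ¬ ∀ᵐ x ∂F, x = c) {hX : ∀ i, Measurable (X i)}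
    (h : IsIID X μ (law F lam)) (h' : IsIID X ν (law F θ)) (hlam : lam ∈ naturalParam F)
    (hθ : θ ∈ naturalParam F) (hlt : θ < lam) {N : Ω → ℕ∞}
    (hN : IsStoppingTime (obsFiltration X hX) N) (hfin : expect μ N ≠ ⊤) :
    0 < errProb ν N ∧
      |Real.log (errProb ν N)| ≤ klInfo F lam θ * (expect μ N).toReal := by
  have := h'.isProbabilityMeasure
  rw [← withDensity_exp_neg_logLR F lam θ] at h'
  simp_rw [logLR_eq_klInfo_add hF hlam] at h'
  have hw0 : ∫ x, (lam - θ) * (x - deriv (logNorm F) lam) ∂(law F lam) = 0 := by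
    rw [integral_const_mul, integral_sub_deriv_logNorm hF hlam, mul_zero]
  have hw2 : MemLp (fun x => (lam - θ) * (x - deriv (logNorm F) lam)) 2 (law F lam) :=
    MemLp.const_mul (by exact_mod_cast memLp_sub_deriv_logNorm hF hlam 2) _
  have key := h.exp_neg_le_errProb (by fun_prop) hw2 hw0 (klInfo_pos hF hlam hθ hlt).le h' hN hfin
  have hpos := (Real.exp_pos _).trans_le key
  refine ⟨hpos, ?_⟩
  rw [abs_of_nonpos (Real.log_nonpos hpos.le measureReal_le_one)]
  have := (Real.le_log_iff_exp_le hpos).2 key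
  linarith

theorem klInfo_mul_le_abs_log_errProb_stopM (hF : ∀ c : ℝ, ¬ ∀ᵐ x ∂F, x = c)
    (hX : ∀ i, Measurable (X i)) (h : IsIID X μ (law F lam)) (h' : IsIID X ν (law F θ))
    (hθ₀ : θ₀ ∈ naturalParam F) (h01 : θ₀ < θ₁) (h1 : θ₁ < lam) (hlam : lam ∈ naturalParam F)
    (hθ : θ ∈ Set.Icc θ₀ θ₁) (hpos : 0 < errProb ν (stopM F X θ₀ θ₁ lam a)) :
    klInfo F lam θ * a ≤ |Real.log (errProb ν (stopM F X θ₀ θ₁ lam a))| := by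
  rw [← withDensity_exp_neg_logLR F lam θ] at h'
  have key := h.errProb_le (measurable_logLR F lam θ) h'
    (isStoppingTime_stopM hF hθ₀ h01 h1 hlam hX a)
    (fun n ω hn => klInfo_mul_le_of_stopM_eq hn hθ)
  have := (Real.log_le_iff_le_exp hpos).2 key
  have := neg_abs_le (Real.log (errProb ν (stopM F X θ₀ θ₁ lam a)))
  linarith

end Asymptotics

end ExpFamilyTest

end

/-! ### The main theorem. -/

open ExpFamilyTest in
theorem corollary2p1 {Ω : Type*} [MeasurableSpace Ω]
    -- the dominating measure, not concentrated on a single point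
    (F : Measure ℝ) [SigmaFinite F] (hF : ∀ c : ℝ, ¬ ∀ᵐ x ∂F, x = c)
    -- the observations and the probability measures `P ξ` under which they are i.i.d. `f_ξ`
    (X : ℕ → Ω → ℝ) (hX : ∀ i, Measurable (X i)) (P : ℝ → Measure Ω)
    (hP : ∀ ξ ∈ ExpFamilyTest.naturalParam F,
      ExpFamilyTest.IsIID X (P ξ) (ExpFamilyTest.law F ξ))
    (θ₀ θ₁ lam : ℝ) (hθ₀ : θ₀ ∈ ExpFamilyTest.naturalParam F) (h01 : θ₀ < θ₁) (h1 : θ₁ < lam)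
    (hlam : lam ∈ ExpFamilyTest.naturalParam F) :
    0 < ExpFamilyTest.constC F θ₀ θ₁ lam ∧
    -- `M(a)` is itself one of the competing stopping times
    (∀ a : ℝ, 0 < a → IsStoppingTime (ExpFamilyTest.obsFiltration X hX)
      (ExpFamilyTest.stopM F X θ₀ θ₁ lam a)) ∧
    ∃ δ ε : ℝ → ℝ, Tendsto δ atTop (𝓝 0) ∧ Tendsto ε atTop (𝓝 0) ∧
      ∀ N : ℝ → Ω → ℕ∞,
        (∀ a : ℝ, 0 < a → IsStoppingTime (ExpFamilyTest.obsFiltration X hX) (N a)) →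
        (∀ a : ℝ, 0 < a → ExpFamilyTest.expect (P lam) (N a) ≤
          ExpFamilyTest.expect (P lam) (ExpFamilyTest.stopM F X θ₀ θ₁ lam a)) →
        ∀ θ ∈ Set.Icc θ₀ θ₁, ∀ a : ℝ, 0 < a →
          -- the logarithm below is a genuine one
          0 < ExpFamilyTest.errProb (P θ) (N a) ∧
          |Real.log (ExpFamilyTest.errProb (P θ) (N a))| / ExpFamilyTest.klInfo F lam θ ≤
            a + (ExpFamilyTest.constC F θ₀ θ₁ lam + δ a) * √a ∧
          -- `M(a)` asymptotically minimizes the error probabilities, simultaneously in `θ`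
          |Real.log (ExpFamilyTest.errProb (P θ) (N a))| / ExpFamilyTest.klInfo F lam θ ≤
            |Real.log (ExpFamilyTest.errProb (P θ) (ExpFamilyTest.stopM F X θ₀ θ₁ lam a))| /
              ExpFamilyTest.klInfo F lam θ +
              (ExpFamilyTest.constC F θ₀ θ₁ lam + δ a) * √a ∧
          |Real.log (ExpFamilyTest.errProb (P θ) (N a))| ≤ (1 + ε a) *
            |Real.log (ExpFamilyTest.errProb (P θ) (ExpFamilyTest.stopM F X θ₀ θ₁ lam a))| := by
  have hC := constC_pos hF hθ₀ h01 h1 hlam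
  have hMst := isStoppingTime_stopM hF hθ₀ h01 h1 hlam hX
  refine ⟨hC, fun a _ => hMst a, ?_⟩
  set C := constC F θ₀ θ₁ lam with hCdef
  set EM : ℝ → ℝ := fun a => (expect (P lam) (stopM F X θ₀ θ₁ lam a)).toReal with hEM
  -- Defined as the normalized excess of `E_λ M(a)`, so that `E_λ M(a) ≤ a + (C + δ a) √a` holds for
  -- every `a > 0`, not just eventually. It depends on neither `N` nor `θ`; the cut at `0` makes it
  -- nonnegative.
  set δ : ℝ → ℝ := fun a => max 0 ((EM a - a) / √a - C) with hδ
  have hδ0 : ∀ a, 0 ≤ δ a := fun a => le_max_left _ _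
  have hδlim : Tendsto δ atTop (𝓝 0) := by
    rw [Metric.tendsto_nhds]
    intro ε hε
    filter_upwards [eventually_expect_stopM_le hF hX (hP lam hlam) hθ₀ h01 h1 hlam (half_pos hε),
      eventually_gt_atTop 0] with a ha ha0
    have hs : 0 < √a := Real.sqrt_pos.2 ha0
    rw [Real.dist_0_eq_abs, abs_of_nonneg (hδ0 a)]
    refine max_lt hε ?_
    rw [sub_lt_iff_lt_add, div_lt_iff₀ hs]
    have : (constC F θ₀ θ₁ lam + ε / 2) * √a < (ε + C) * √a := by
      refine mul_lt_mul_of_pos_right ?_ hs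
      linarith
    simp only [hEM]
    linarith
  -- The relative error is the excess `(C + δ a) √a` divided by the leading term `a`.
  refine ⟨δ, fun a => (C + δ a) / √a, hδlim, ?_, fun N hN hNM θ hθ a ha => ?_⟩
  · have := (hδlim.const_add C).mul (tendsto_inv_atTop_zero.comp Real.tendsto_sqrt_atTop)
    simpa [div_eq_mul_inv] using this
  have hs : 0 < √a := Real.sqrt_pos.2 ha
  have hθp := mem_naturalParam_of_mem_Icc hθ₀ hlam h1 hθ
  have hθlt : θ < lam := hθ.2.trans_lt h1
  have hI := klInfo_pos hF hlam hθp hθlt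
  have hMfin := expect_stopM_ne_top hF hX (hP lam hlam) hθ₀ h01 h1 hlam ha
  have hNfin := ne_top_of_le_ne_top hMfin (hNM a ha)
  obtain ⟨hNpos, hNlog⟩ :=
    neg_log_errProb_le hF (hP lam hlam) (hP θ hθp) hlam hθp hθlt (hN a ha) hNfin
  have hMpos :=
    (neg_log_errProb_le hF (hP lam hlam) (hP θ hθp) hlam hθp hθlt (hMst a) hMfin).1
  have hMlog := klInfo_mul_le_abs_log_errProb_stopM hF hX (hP lam hlam) (hP θ hθp) hθ₀ h01 h1
    hlam hθ hMpos
  have hE : EM a ≤ a + (C + δ a) * √a := by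
    have : (EM a - a) / √a ≤ C + δ a := by
      have := le_max_right 0 ((EM a - a) / √a - C)
      simp only [hδ]
      linarith
    rw [div_le_iff₀ hs] at this
    linarith
  have hNE : (expect (P lam) (N a)).toReal ≤ EM a := ENNReal.toReal_mono hMfin (hNM a ha)
  have hNlog' : |Real.log (errProb (P θ) (N a))| ≤
      klInfo F lam θ * (a + (C + δ a) * √a) :=
    hNlog.trans (mul_le_mul_of_nonneg_left (hNE.trans hE) hI.le)
  have hfirst : |Real.log (errProb (P θ) (N a))| / klInfo F lam θ ≤ a + (C + δ a) * √a := by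
    rwa [div_le_iff₀' hI]
  have hMdiv : a ≤ |Real.log (errProb (P θ) (stopM F X θ₀ θ₁ lam a))| / klInfo F lam θ := by
    rwa [le_div_iff₀' hI]
  refine ⟨hNpos, hfirst, by linarith, hNlog'.trans ?_⟩
  have hε0 : 0 ≤ 1 + (C + δ a) / √a := by have := hδ0 a; positivity
  calc klInfo F lam θ * (a + (C + δ a) * √a)
      = (1 + (C + δ a) / √a) * (klInfo F lam θ * a) := by
        have : √a * √a = a := Real.mul_self_sqrt ha.le
        have e : (C + δ a) / √a * a = (C + δ a) * √a := by
          rw [div_mul_eq_mul_div, div_eq_iff hs.ne', mul_assoc, this]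
        rw [← e]; ring
    _ ≤ _ := mul_le_mul_of_nonneg_left hMlog hε0
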